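/- **Model.** A network is a graph $G$ on $n$ vertices with distinct vertex identifiers $\mathrm{ID}(v)\in[1,n^a]$, where $a$ is a fixed constant. It is a $\phi$-expander ($\phi>0$) if $|\delta(S)|\ge\phi\cdot\min(\mathrm{vol}(S),\mathrm{vol}(V\setminus S))$ for every $\emptyset\ne S\subsetneq V$ and $G$ is connected, where $\mathrm{vol}(S)=\sum_{v\in S}\deg(v)$ and $\delta(S)$ is the set of edges leaving $S$. Let $\Delta(n)$ be any bound on the maximum degree (for instance a constant); all networks on $n$ vertices are assumed to have maximum degree at most $\Delta(n)$. In the (deterministic) CONGEST model, each vertex knows $n,\phi,L$, its own identifier, the identifiers of its neighbours and its own tokens; in each synchronous round it sends a message of $O(\log n)$ bits to each neighbour, receives those of its neighbours, and performs arbitrary local computation. **ExpanderSorting.** Each vertex holds at most $L$ tokens, and each token $z$ has a key $k_z$ from a linearly ordered set. Goal: redistribute the tokens so that each vertex holds at most $L$ tokens and, for tokens $z,z'$ located at vertices $v,v'$ with $\mathrm{ID}(v)<\mathrm{ID}(v')$, one has $k_z\le k_{z'}$. **ExpanderRouting.** Each vertex holds at most $L$ tokens. Each token $z$ carries $O(\log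 n)$ bits of data and a destination identifier $\mathrm{dst}_z\in[1,n^a]$, and at most $L$ tokens have the same destination identifier. Goal: for each vertex $v$, all tokens with $\mathrm{dst}_z=\mathrm{ID}(v)$ are located at $v$. A CONGEST algorithm for sorting is *comparison-based* if it handles tokens as opaque objects: a message consists of $O(1)$ tokens and $O(\log n)$ further bits, and the actions of a vertex depend on the keys only through the outcomes of comparisons among the keys of tokens that this vertex has held or received. **Lemma.** There is a universal constant $C$ with the following property. Suppose that a comparison-based CONGEST algorithm solves ExpanderSorting with maximum load $L$ on all $n$-vertex $\phi$-expanders in $T_{\mathrm{sort}}(n,\phi,L)$ rounds, for all $n$, $\phi>0$ and $L$. Then there is a CONGEST algorithm that solves ExpanderRouting with maximum load $L$ on all $n$-vertex $\phi$-expanders in at most $C\cdot T_{\mathrm{sort}}(n,\phi,2L)$ rounds, for all $n$, $\phi>0$ and $L$. The constant in its $O(\log n)$ message size depends only on $a$ and on the constants in the token data size and in the message size of the sorting algorithm. -/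

import Mathlib

namespace Congest

/-! ### Expander graphs and networks -/

open Classical in
/-- The volume of a vertex set: the sum of the degrees of its vertices. -/
noncomputable def vol {n : ℕ} (G : SimpleGraph (Fin n)) (S : Finset (Fin n)) : ℕ :=
  ∑ v ∈ S, G.degree v

open Classical in
/-- The conductance of the cut `S`: the number of edges that leave `S`, divided by the smaller of
the volumes of `S` and of its complement. (If that volume is `0`, no edge leaves `S`, the graph is
disconnected, and the value is `0`.) -/
noncomputable def cutConductance {n : ℕ} (G : SimpleGraph (Fin n)) (S : Finset (Fin n)) : ℝ :=
  ((G.interedges S Sᶜ).card : ℝ) / (min (vol G S) (vol G Sᶜ) : ℕ)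

/-- `G` is a `φ`-expander: every cut `∅ ≠ S ≠ V` has conductance at least `φ`. -/
def IsExpander {n : ℕ} (G : SimpleGraph (Fin n)) (φ : ℝ) : Prop :=
  ∀ S : Finset (Fin n), S.Nonempty → S ≠ Finset.univ → φ ≤ cutConductance G S

/-- A network on `n` vertices: a graph together with distinct vertex identifiers. The vertex names
in `Fin n` are never shown to the processors; these only see identifiers. -/
structure Network (n : ℕ) where
  graph : SimpleGraph (Fin n)
  id : Fin n → ℕ
  id_injective : Function.Injective id

open Classical in
/-- The network is a `φ`-expander of maximum degree at most `Δ` with identifiers in `[1, N]`. -/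
def Network.Admissible {n : ℕ} (net : Network n) (φ : ℝ) (Δ N : ℕ) : Prop :=
  IsExpander net.graph φ ∧ (∀ v, net.graph.degree v ≤ Δ) ∧ ∀ v, 1 ≤ net.id v ∧ net.id v ≤ N

open Classical in
/-- The neighbours of `v`, listed by increasing identifier. -/
noncomputable def Network.nbrs {n : ℕ} (net : Network n) (v : Fin n) : List (Fin n) :=
  (net.graph.neighborFinset v).toList.mergeSort (fun a b => decide (net.id a ≤ net.id b))

/-! ### Synchronous message passing -/

/-- The deterministic program that every processor runs, for local inputs in `Inp`, messages in
`Msg` and local outputs in `Out`. Local computation is unrestricted. A processor starts from its own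
identifier, the list of the identifiers of its neighbours and its local input. In a round it sends
one message to each neighbour (`send s j` is the message to the neighbour with identifier `j`) and
then updates its state from the messages received, each tagged with the identifier of its sender
and listed by increasing identifier. -/
structure NodeProgram (Inp Msg Out : Type) where
  State : Type
  init : (ownId : ℕ) → (nbrIds : List ℕ) → Inp → State
  send : State → ℕ → Msg
  recv : State → List (ℕ × Msg) → State
  output : State → Out

namespace NodeProgram

variable {Inp Msg Out : Type} {n : ℕ}

/-- The state of each processor after `t` rounds. -/
noncomputable def run (P : NodeProgram Inp Msg Out) (net : Network n) (inp : Fin n → Inp) :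
    ℕ → Fin n → P.State
  | 0 => fun v => P.init (net.id v) ((net.nbrs v).map net.id) (inp v)
  | t + 1 => fun v =>
      P.recv (run P net inp t v)
        ((net.nbrs v).map fun u => (net.id u, P.send (run P net inp t u) (net.id v)))

/-- The local output of each processor after `t` rounds. -/
noncomputable def result (P : NodeProgram Inp Msg Out) (net : Network n) (inp : Fin n → Inp)
    (t : ℕ) (v : Fin n) : Out :=
  P.output (P.run net inp t v)

end NodeProgram

/-- The number of bits of `n`; `Θ(log n)` for `n ≥ 2`. -/
def bits (n : ℕ) : ℕ := Nat.log 2 n + 1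

/-- Bit strings of length `c * bits n`, that is, of length `O(log n)`. -/
abbrev Word (n c : ℕ) : Type := Fin (2 ^ (c * bits n))

/-- A `CONGEST` algorithm for `n`-vertex networks: each message consists of `c * bits n` bits. -/
abbrev CongestAlg (n c : ℕ) (Inp Out : Type) : Type 1 := NodeProgram Inp (Word n c) Out

/-! ### Comparison-based algorithms on tokens -/

/-- The outcomes of all key comparisons among the tokens of a list: it tells for which positions
`i`, `j` of the list the key of the `i`-th token is at most the key of the `j`-th token. -/
def comparisons {Z : Type} (key : Z → ℕ) (R : List Z) : ℕ → ℕ → Prop :=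
  fun i j => ∃ a ∈ R[i]?, ∃ b ∈ R[j]?, key a ≤ key b

/-- A deterministic comparison-based `CONGEST` algorithm on tokens, for `n`-vertex networks. Tokens
are opaque objects. A processor remembers, in a list of registers, the tokens that it held at the
start and those that it received later, and it has a control state. All it does is determined by the
control state and by the outcomes of the comparisons among the keys of the tokens in its registers.
A message consists of a control word of `c * bits n` bits and of at most `c` tokens (in `c` slots,
each empty or filled with a token from the register of the given index).

* `init` sees the own identifier, the identifiers of the neighbours and the number of tokens held.
* `recv` sees, for each neighbour, its identifier, the control word and which slots are filled; the
  comparisons it sees already include the tokens just received.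
* `output` lists the registers whose tokens are finally located at this vertex. -/
structure ComparisonAlg (n c : ℕ) where
  Ctrl : Type
  init : (ownId : ℕ) → (nbrIds : List ℕ) → (load : ℕ) → Ctrl
  send : Ctrl → (ℕ → ℕ → Prop) → ℕ → Word n c × (Fin c → Option ℕ)
  recv : Ctrl → (ℕ → ℕ → Prop) → List (ℕ × Word n c × (Fin c → Bool)) → Ctrl
  output : Ctrl → (ℕ → ℕ → Prop) → List ℕ

/-- The execution of a comparison-based algorithm on the tokens of a type `Z` with keys `key`:
the state consists of the control state and the registers. -/
def ComparisonAlg.toProgram {n c : ℕ} (A : ComparisonAlg n c) {Z : Type} (key : Z → ℕ) :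
    NodeProgram (List Z) (Word n c × (Fin c → Option Z)) (List Z) where
  State := A.Ctrl × List Z
  init := fun i nb held => (A.init i nb held.length, held)
  send := fun s j =>
    let m := A.send s.1 (comparisons key s.2) j
    (m.1, fun k => (m.2 k).bind fun i => s.2[i]?)
  recv := fun s inbox =>
    let R := s.2 ++ inbox.flatMap fun m => (List.ofFn m.2.2).reduceOption
    (A.recv s.1 (comparisons key R) (inbox.map fun m => (m.1, m.2.1, fun k => (m.2.2 k).isSome)), R)
  output := fun s => (A.output s.1 (comparisons key s.2)).filterMap fun i => s.2[i]?

/-! ### The two problems -/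

/-- Every token of `Z` is located at exactly one vertex, where it is listed exactly once. -/
def IsPlacement {n : ℕ} {Z : Type} (place : Fin n → List Z) : Prop :=
  (∀ z, ∃! v, z ∈ place v) ∧ ∀ v, (place v).Nodup

/-- The algorithm solves expander sorting with maximum load `L` in `T` rounds, on all `φ`-expanders
with `n` vertices, maximum degree at most `Δ` and identifiers in `[1, N]`. -/
def ComparisonAlg.SolvesSorting {n c : ℕ} (A : ComparisonAlg n c) (φ : ℝ) (Δ N L T : ℕ) : Prop :=
  ∀ net : Network n, net.Admissible φ Δ N →
  ∀ (Z : Type) (key : Z → ℕ) (held : Fin n → List Z),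
    IsPlacement held → (∀ v, (held v).length ≤ L) →
    let out := (A.toProgram key).result net held T
    IsPlacement out ∧ (∀ v, (out v).length ≤ L) ∧
      ∀ v v', net.id v < net.id v' → ∀ z ∈ out v, ∀ z' ∈ out v', key z ≤ key z'

/-- A token of a routing instance: the identifier of its destination, and the data it carries. -/
structure RouteToken where
  dst : ℕ
  data : ℕ

open Classical in
/-- The tokens of an instance that have destination identifier `d`. Tokens may agree in destination
and data, so they form a multiset. -/
noncomputable def tokensTo {n : ℕ} (held : Fin n → List RouteToken) (d : ℕ) :
    Multiset RouteToken :=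
  (∑ v, (held v : Multiset RouteToken)).filter fun z => z.dst = d

/-- The algorithm solves expander routing with maximum load `L` in `T` rounds, on all `φ`-expanders
with `n` vertices, maximum degree at most `Δ` and identifiers in `[1, N]`, for tokens that carry
`b * bits n` bits of data: finally the tokens located at `v` are exactly those with destination
`v`. (Destination identifiers that belong to no vertex are allowed; nothing is required of such
tokens beyond their not being delivered to a wrong vertex.) -/
def CongestAlg.SolvesRouting {n c : ℕ}
    (A : CongestAlg n c (List RouteToken) (List RouteToken)) (φ : ℝ) (Δ N b L T : ℕ) : Prop :=
  ∀ net : Network n, net.Admissible φ Δ N →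
  ∀ held : Fin n → List RouteToken,
    (∀ v, ∀ z ∈ held v, (1 ≤ z.dst ∧ z.dst ≤ N) ∧ z.data < 2 ^ (b * bits n)) →
    (∀ v, (held v).length ≤ L) →
    (∀ d, (tokensTo held d).card ≤ L) →
    ∀ v, ((NodeProgram.result A net held T v : List RouteToken) : Multiset RouteToken) = tokensTo held (net.id v)

end Congest

/-! Every vertex pads its at most `L` tokens with blanks to `L` and adds `L` dummy tokens keyed by
its own identifier; a dummy for `d` precedes all routed tokens for `d`. In sorted order the `L`
dummies for `d` are directly followed by the at most `L` routed tokens for `d`, so each routed token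
stands exactly `L` positions behind a dummy of its destination (`sum_routed_shift`). It remains to
tell each dummy what stands `L` positions behind it, and to carry this answer to the origin of the
dummy.

The sorted sequence is cut into blocks of length `2 * L`, one per vertex by increasing identifier. A
dummy in the first half of a block has its partner in the same block. For the second halves, the
vertex of smallest identifier turns its first `L` tokens into blanks; sorting again shifts the whole
sequence by `L` (`blockSeq_shift`), and second halves become first halves. To find the vertex of
smallest identifier, a preliminary sorting takes one dummy per vertex and otherwise blanks: as
blocks have length at least 2, only that vertex sees its own dummy again (`dummy_mem_iff`).
`sum_replies` shows that the two sortings together answer with exactly the routed tokens for `d`.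

Answers travel home by running a sorting backwards (`reverse_run`): recorded states and inboxes tell
from which register of which neighbour each token was copied. The second sorting is undone first,
then the first. Three sortings and two reversals give the factor 5.

The sorting guarantee is about distinct abstract tokens, whereas the messages sent here carry
values, which may coincide. Since a comparison-based run commutes with relabelling (`state_map`),
the run on values is the image of a run on the labels `(v, j)`, and `exists_perm` extracts from the
latter a permutation of these labels. -/

namespace Congest

/-! ### Combinators for node programs -/

namespace NodeProgram

variable {I I' X M M' O : Type} {n : ℕ}

/-- Run `P` for `T` rounds, then `Q` on its outputs. -/
def seq (P : NodeProgram I M X) (T : ℕ) (Q : NodeProgram X M O) : NodeProgram I M O :=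
  let enter : ℕ → List ℕ → ℕ → P.State → (ℕ × List ℕ × ℕ × P.State) ⊕ Q.State :=
    fun i nb k s => if k = 0 then .inr (Q.init i nb (P.output s)) else .inl (i, nb, k, s)
  { State := (ℕ × List ℕ × ℕ × P.State) ⊕ Q.State
    init := fun i nb inp => enter i nb T (P.init i nb inp)
    send := fun s j => s.elim (fun s => P.send s.2.2.2 j) (fun s => Q.send s j)
    recv := fun s inbox => s.elim
      (fun s => enter s.1 s.2.1 (s.2.2.1 - 1) (P.recv s.2.2.2 inbox)) (fun s => .inr (Q.recv s inbox))
    output := fun s => s.elim (fun s => Q.output (Q.init s.1 s.2.1 (P.output s.2.2.2))) Q.output }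

/-- The counter holds the number of rounds left to `P`. At `0` the switch to `Q` is part of the same
local step, so running times add up exactly. -/
theorem seq_run_of_le (P : NodeProgram I M X) (T : ℕ) (Q : NodeProgram X M O) (net : Network n)
    (inp : Fin n → I) (t : ℕ) (ht : t ≤ T) :
    (seq P T Q).run net inp t = fun v =>
      if T - t = 0 then
        Sum.inr (Q.init (net.id v) ((net.nbrs v).map net.id) (P.output (P.run net inp t v)))
      else Sum.inl (net.id v, (net.nbrs v).map net.id, T - t, P.run net inp t v) := by
  induction t with
  | zero => rfl
  | succ t ih =>
    have h1 : T - t ≠ 0 := by omega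
    have h2 : T - t - 1 = T - (t + 1) := by omega
    funext v
    rw [run, ih (by omega)]
    simp only [h1, if_false]
    rw [← h2]
    rfl

theorem seq_run_add (P : NodeProgram I M X) (T : ℕ) (Q : NodeProgram X M O) (net : Network n)
    (inp : Fin n → I) (t : ℕ) :
    (seq P T Q).run net inp (T + t) = fun v => Sum.inr (Q.run net (P.result net inp T) t v) := by
  induction t with
  | zero =>
    rw [Nat.add_zero, seq_run_of_le _ _ _ _ _ _ le_rfl]
    simp only [Nat.sub_self, if_true]
    rfl
  | succ t ih =>
    funext v
    rw [← Nat.add_assoc, run, ih]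
    rfl

theorem seq_result (P : NodeProgram I M X) (T : ℕ) (Q : NodeProgram X M O) (net : Network n)
    (inp : Fin n → I) (t : ℕ) :
    (seq P T Q).result net inp (T + t) = Q.result net (P.result net inp T) t := by
  funext v
  rw [result, seq_run_add]
  rfl

/-- Split the input by a local computation into a context, which is kept, and the input of `P`. -/
def withContext (pre : ℕ → I → X × I') (P : NodeProgram I' M O) : NodeProgram I M (X × O) where
  State := X × P.State
  init := fun i nb inp => ((pre i inp).1, P.init i nb (pre i inp).2)
  send := fun s j => P.send s.2 j
  recv := fun s inbox => (s.1, P.recv s.2 inbox)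
  output := fun s => (s.1, P.output s.2)

theorem withContext_result (pre : ℕ → I → X × I') (P : NodeProgram I' M O) (net : Network n)
    (inp : Fin n → I) (t : ℕ) :
    (withContext pre P).result net inp t = fun v => ((pre (net.id v) (inp v)).1,
      P.result net (fun v => (pre (net.id v) (inp v)).2) t v) := by
  have h : (withContext pre P).run net inp t = fun v => ((pre (net.id v) (inp v)).1,
      P.run net (fun v => (pre (net.id v) (inp v)).2) t v) := by
    induction t with
    | zero => rfl
    | succ t ih => funext v; rw [run, ih]; rfl
  funext v
  rw [result, h]
  rfl

/-- Encode the messages of a program. -/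
def mapMsg (enc : M → M') (dec : M' → M) (P : NodeProgram I M O) : NodeProgram I M' O where
  State := P.State
  init := P.init
  send := fun s j => enc (P.send s j)
  recv := fun s inbox => P.recv s (inbox.map fun m => (m.1, dec m.2))
  output := P.output

theorem mapMsg_result (enc : M → M') (dec : M' → M) (h : ∀ m, dec (enc m) = m)
    (P : NodeProgram I M O) (net : Network n) (inp : Fin n → I) (t : ℕ) :
    (mapMsg enc dec P).result net inp t = P.result net inp t := by
  have hr : (mapMsg enc dec P).run net inp t = P.run net inp t := by
    induction t with
    | zero => rfl
    | succ t ih =>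
      funext v
      rw [run, ih, run]
      simp only [mapMsg, List.map_map, Function.comp_def, h]
  funext v
  rw [result, hr]
  rfl

/-- Post-compose the output with a local computation. -/
def mapOut (f : O → X) (P : NodeProgram I M O) : NodeProgram I M X where
  State := P.State
  init := P.init
  send := P.send
  recv := P.recv
  output := fun s => f (P.output s)

theorem mapOut_result (f : O → X) (P : NodeProgram I M O) (net : Network n)
    (inp : Fin n → I) (t : ℕ) :
    (mapOut f P).result net inp t = fun v => f (P.result net inp t v) := by
  have hr : (mapOut f P).run net inp t = P.run net inp t := by
    induction t with
    | zero => rfl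
    | succ t ih => funext v; rw [run, ih, run]; rfl
  funext v
  rw [result, hr]
  rfl

/-- The messages that `v` receives in round `t`. -/
noncomputable def inbox (P : NodeProgram I M O) (net : Network n) (inp : Fin n → I) (t : ℕ)
    (v : Fin n) : List (ℕ × M) :=
  (net.nbrs v).map fun u => (net.id u, P.send (P.run net inp t u) (net.id v))

/-- The states and inboxes of the rounds before round `t`, the last round first. -/
noncomputable def log (P : NodeProgram I M O) (net : Network n) (inp : Fin n → I) :
    ℕ → Fin n → List (P.State × List (ℕ × M))
  | 0, _ => []
  | t + 1, v => (P.run net inp t v, P.inbox net inp t v) :: log P net inp t v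

/-- Run `P` and record the states and inboxes of all rounds. -/
def logged (P : NodeProgram I M O) :
    NodeProgram I M (List (P.State × List (ℕ × M)) × P.State) where
  State := List (P.State × List (ℕ × M)) × P.State
  init := fun i nb inp => ([], P.init i nb inp)
  send := fun s j => P.send s.2 j
  recv := fun s inbox => ((s.2, inbox) :: s.1, P.recv s.2 inbox)
  output := id

theorem logged_result (P : NodeProgram I M O) (net : Network n) (inp : Fin n → I) (t : ℕ) :
    P.logged.result net inp t = fun v => (P.log net inp t v, P.run net inp t v) := by
  have hr : P.logged.run net inp t = fun v => (P.log net inp t v, P.run net inp t v) := by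
    induction t with
    | zero => rfl
    | succ t ih => funext v; rw [run, ih]; rfl
  funext v
  rw [result, hr]
  rfl

end NodeProgram

theorem Network.mem_nbrs {n : ℕ} (net : Network n) (u v : Fin n) :
    u ∈ net.nbrs v ↔ net.graph.Adj v u := by
  simp [Network.nbrs, List.mem_mergeSort]

/-! ### Parametricity of comparison-based algorithms -/

theorem comparisons_map {Z Z' : Type} (f : Z → Z') (key : Z' → ℕ) (R : List Z) :
    comparisons key (R.map f) = comparisons (key ∘ f) R := by
  funext i j
  simp [comparisons]

theorem List.reduceOption_ofFn_map {Z Z' : Type} {c : ℕ} (f : Z → Z') (g : Fin c → Option Z) :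
    (List.ofFn fun k => (g k).map f).reduceOption = (List.ofFn g).reduceOption.map f := by
  rw [← List.reduceOption_map, List.map_ofFn]
  rfl

theorem NodeProgram.run_simulation {I I' M M' O O' : Type} {n : ℕ} (P : NodeProgram I M O)
    (Q : NodeProgram I' M' O') (net : Network n) (inp : Fin n → I) (inp' : Fin n → I')
    (f : P.State → Q.State) (g : M → M')
    (hinit : ∀ i nb v, Q.init i nb (inp' v) = f (P.init i nb (inp v)))
    (hsend : ∀ s j, Q.send (f s) j = g (P.send s j))
    (hrecv : ∀ s l, Q.recv (f s) (l.map fun m => (m.1, g m.2)) = f (P.recv s l)) (t : ℕ)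
    (v : Fin n) : Q.run net inp' t v = f (P.run net inp t v) := by
  induction t generalizing v with
  | zero => exact hinit _ _ v
  | succ t ih =>
    simp only [NodeProgram.run, ih, hsend, ← hrecv, List.map_map, Function.comp_def]

/-- The control state and the registers of each processor after `t` rounds. -/
noncomputable def ComparisonAlg.state {n c : ℕ} (A : ComparisonAlg n c) {Z : Type} (key : Z → ℕ)
    (net : Network n) (held : Fin n → List Z) (t : ℕ) (v : Fin n) : A.Ctrl × List Z :=
  (A.toProgram key).run net held t v

/-- The control part sees tokens only through comparisons, and these agree for `R.map f` under `key`
and for `R` under `key ∘ f`. Runs on values that may coincide can thus be analysed on distinct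
labels. -/
theorem ComparisonAlg.state_map {n c : ℕ} (A : ComparisonAlg n c) {Z Z' : Type} (f : Z → Z')
    (key : Z' → ℕ) (net : Network n) (held : Fin n → List Z) (t : ℕ) (v : Fin n) :
    A.state key net (fun v => (held v).map f) t v =
      ((A.state (key ∘ f) net held t v).1, (A.state (key ∘ f) net held t v).2.map f) := by
  refine NodeProgram.run_simulation (A.toProgram (key ∘ f)) (A.toProgram key) net held _
    (fun s : A.Ctrl × List Z => ((s.1, s.2.map f) : A.Ctrl × List Z'))
    (fun m => (m.1, fun k => (m.2 k).map f)) ?_ ?_ ?_ t v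
  · intro i nb v
    simp [toProgram]
  · intro s j
    simp only [toProgram, comparisons_map, List.getElem?_map]
    congr 1
    funext k
    cases (A.send s.1 (comparisons (key ∘ f) s.2) j).2 k <;> rfl
  · intro s l
    have hR : ((l.map fun m => (m.1, m.2.1, fun k => (m.2.2 k).map f)).flatMap
          fun m => (List.ofFn m.2.2).reduceOption) =
        (l.flatMap fun m => (List.ofFn m.2.2).reduceOption).map f := by
      simp only [List.flatMap_map, List.map_flatMap, List.reduceOption_ofFn_map]
    simp only [toProgram]
    rw [hR, ← List.map_append, comparisons_map, List.map_map]
    simp only [Function.comp_def, Option.isSome_map]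

/-! ### Reversing the execution of a comparison-based algorithm -/

open Classical in
/-- Some element that satisfies `p`, if there is one. -/
noncomputable def pick {Y : Type} (p : Y → Prop) : Option Y :=
  if h : ∃ y, p y then some h.choose else none

theorem pick_spec {Y : Type} {p : Y → Prop} {y : Y} (h : pick p = some y) : p y := by
  unfold pick at h
  split_ifs at h with hp
  cases h
  exact hp.choose_spec

theorem exists_pick {Y : Type} {p : Y → Prop} {y : Y} (h : p y) : ∃ y', pick p = some y' := by
  have hp : ∃ y, p y := ⟨y, h⟩
  exact ⟨_, dif_pos hp⟩

/-- The tokens in a list of messages, labelled with sender and slot. -/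
def labelledTokens {β Z : Type} {c : ℕ} (inbox : List (ℕ × β × (Fin c → Option Z))) :
    List ((ℕ × Fin c) × Z) :=
  inbox.flatMap fun m => (List.ofFn fun k => (m.2.2 k).map fun z => ((m.1, k), z)).reduceOption

theorem labelledTokens_map_snd {β Z : Type} {c : ℕ}
    (inbox : List (ℕ × β × (Fin c → Option Z))) :
    (labelledTokens inbox).map Prod.snd =
      inbox.flatMap fun m => (List.ofFn m.2.2).reduceOption := by
  simp only [labelledTokens, List.map_flatMap, ← List.reduceOption_map, List.map_ofFn,
    Function.comp_def, Option.map_map, Option.map_id']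

/-- Sender and slot do not depend on the token values, so the log of the run on values suffices to
trace labels backwards. -/
theorem labelledTokens_map_fst {β Z Z' : Type} {c : ℕ} (f : Z → Z')
    (inbox : List (ℕ × β × (Fin c → Option Z))) :
    (labelledTokens (inbox.map fun m => (m.1, m.2.1, fun k => (m.2.2 k).map f))).map Prod.fst =
      (labelledTokens inbox).map Prod.fst := by
  simp only [labelledTokens, List.map_flatMap, List.flatMap_map, ← List.reduceOption_map,
    List.map_ofFn, Function.comp_def, Option.map_map]

theorem mem_labelledTokens {β Z : Type} {c : ℕ} {inbox : List (ℕ × β × (Fin c → Option Z))}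
    {x : (ℕ × Fin c) × Z} :
    x ∈ labelledTokens inbox ↔ ∃ m ∈ inbox, m.1 = x.1.1 ∧ m.2.2 x.1.2 = some x.2 := by
  obtain ⟨⟨j, k⟩, z⟩ := x
  simp only [labelledTokens, List.mem_flatMap, List.reduceOption_mem_iff, List.mem_ofFn]
  constructor
  · rintro ⟨m, hm, k', h⟩
    cases hz : m.2.2 k' with
    | none => simp [hz] at h
    | some z' =>
      simp only [hz, Option.map_some, Option.some.injEq, Prod.mk.injEq] at h
      obtain ⟨⟨h1, rfl⟩, rfl⟩ := h
      exact ⟨m, hm, h1, hz⟩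
  · rintro ⟨m, hm, h1, h2⟩
    exact ⟨m, hm, k, by rw [show m.2.2 k = some z from h2, show m.1 = j from h1]; rfl⟩

namespace ComparisonAlg

variable {n c : ℕ}

/-- What a processor records about a round: its state, and the messages received. -/
abbrev Record (A : ComparisonAlg n c) (Z : Type) : Type :=
  (A.Ctrl × List Z) × List (ℕ × Word n c × (Fin c → Option Z))

/-- Run an execution backwards: every register may hold a reply for its token, and replies are sent
back along the way on which the tokens were received. -/
noncomputable def reverse (A : ComparisonAlg n c) {Z : Type} (key : Z → ℕ) (Y : Type) :
    NodeProgram (List (A.Record Z) × (ℕ → Option Y)) (Fin c → Option Y) (ℕ → Option Y) where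
  State := List (A.Record Z) × (ℕ → Option Y)
  init := fun _ _ inp => inp
  send := fun s j k => s.1.head?.bind fun e =>
    pick fun y => ∃ i : ℕ, ((labelledTokens e.2).map Prod.fst)[i]? = some (j, k) ∧
      s.2 (e.1.2.length + i) = some y
  recv := fun s inbox => (s.1.tail, fun i => s.1.head?.bind fun e =>
    pick fun y => s.2 i = some y ∨ ∃ m ∈ inbox, ∃ k, m.2 k = some y ∧
      (A.send e.1.1 (comparisons key e.1.2) m.1).2 k = some i)
  output := fun s => s.2

/-- The message that `u` sends in round `t` to the neighbour with identifier `j`. -/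
noncomputable def message (A : ComparisonAlg n c) {Z : Type} (key : Z → ℕ) (net : Network n)
    (held : Fin n → List Z) (t : ℕ) (u : Fin n) (j : ℕ) : Word n c × (Fin c → Option Z) :=
  (A.toProgram key).send (A.state key net held t u) j

/-- The messages that `v` receives in round `t`. -/
noncomputable def received (A : ComparisonAlg n c) {Z : Type} (key : Z → ℕ) (net : Network n)
    (held : Fin n → List Z) (t : ℕ) (v : Fin n) : List (ℕ × Word n c × (Fin c → Option Z)) :=
  (net.nbrs v).map fun u => (net.id u, A.message key net held t u (net.id v))

/-- The records of the rounds before round `t`, the last round first. -/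
noncomputable def records (A : ComparisonAlg n c) {Z : Type} (key : Z → ℕ) (net : Network n)
    (held : Fin n → List Z) : ℕ → Fin n → List (A.Record Z)
  | 0, _ => []
  | t + 1, v => (A.state key net held t v, A.received key net held t v) ::
      records A key net held t v

theorem log_eq_records (A : ComparisonAlg n c) {Z : Type} (key : Z → ℕ) (net : Network n)
    (held : Fin n → List Z) (t : ℕ) (v : Fin n) :
    (A.toProgram key).log net held t v = A.records key net held t v := by
  induction t with
  | zero => rfl
  | succ t ih => rw [NodeProgram.log, ih]; rfl

theorem state_succ_regs (A : ComparisonAlg n c) {Z : Type} (key : Z → ℕ) (net : Network n)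
    (held : Fin n → List Z) (t : ℕ) (v : Fin n) :
    (A.state key net held (t + 1) v).2 = (A.state key net held t v).2 ++
      (labelledTokens (A.received key net held t v)).map Prod.snd := by
  rw [labelledTokens_map_snd]
  rfl

theorem message_slot (A : ComparisonAlg n c) {Z : Type} (key : Z → ℕ) (net : Network n)
    (held : Fin n → List Z) (t : ℕ) (u : Fin n) (j : ℕ) (k : Fin c) :
    (A.message key net held t u j).2 k =
      ((A.send (A.state key net held t u).1 (comparisons key (A.state key net held t u).2) j).2
        k).bind fun i => (A.state key net held t u).2[i]? := rfl

theorem message_map (A : ComparisonAlg n c) {Z Z' : Type} (f : Z → Z') (key : Z' → ℕ)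
    (net : Network n) (held : Fin n → List Z) (t : ℕ) (u : Fin n) (j : ℕ) :
    A.message key net (fun v => (held v).map f) t u j =
      ((A.message (key ∘ f) net held t u j).1,
        fun k => ((A.message (key ∘ f) net held t u j).2 k).map f) := by
  rw [message, state_map]
  simp only [message, toProgram, comparisons_map, List.getElem?_map]
  congr 1
  funext k
  cases (A.send (A.state (key ∘ f) net held t u).1
    (comparisons (key ∘ f) (A.state (key ∘ f) net held t u).2) j).2 k <;> rfl

theorem received_map (A : ComparisonAlg n c) {Z Z' : Type} (f : Z → Z') (key : Z' → ℕ)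
    (net : Network n) (held : Fin n → List Z) (t : ℕ) (v : Fin n) :
    A.received key net (fun v => (held v).map f) t v =
      (A.received (key ∘ f) net held t v).map
        fun m => (m.1, m.2.1, fun k => (m.2.2 k).map f) := by
  simp only [received, message_map, List.map_map, Function.comp_def]

/-- In the course of the reversed execution, replies stay with their tokens and none gets lost. -/
theorem reverse_run (A : ComparisonAlg n c) {Z Z' Y : Type} (f : Z → Z') (key : Z' → ℕ)
    (net : Network n) (held : Fin n → List Z) (r : Z → Y) (g : Fin n → ℕ → Option Y) (T s t : ℕ)
    (hT : t + s = T)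
    (hsound : ∀ v i y z, g v i = some y →
      (A.state (key ∘ f) net held T v).2[i]? = some z → y = r z)
    (hcomplete : ∀ z, ∃ v i y,
      (A.state (key ∘ f) net held T v).2[i]? = some z ∧ g v i = some y) :
    ∃ g' : Fin n → ℕ → Option Y,
      ((A.reverse key Y).run net (fun v =>
        (A.records key net (fun v => (held v).map f) T v, g v)) s =
        fun v => (A.records key net (fun v => (held v).map f) t v, g' v)) ∧
      (∀ v i y z, g' v i = some y →
        (A.state (key ∘ f) net held t v).2[i]? = some z → y = r z) ∧
      ∀ z, ∃ v i y, (A.state (key ∘ f) net held t v).2[i]? = some z ∧ g' v i = some y := by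
  induction s generalizing t with
  | zero => exact ⟨g, by subst hT; rfl, by subst hT; exact hsound, by subst hT; exact hcomplete⟩
  | succ s ih =>
    obtain ⟨g₁, hrun, hs₁, hc₁⟩ := ih (t + 1) (by omega)
    set R : Fin n → List Z := fun v => (A.state (key ∘ f) net held t v).2 with hR
    set LT := fun v => labelledTokens (A.received (key ∘ f) net held t v) with hLT
    have hregs : ∀ v, (A.state (key ∘ f) net held (t + 1) v).2 = R v ++ (LT v).map Prod.snd :=
      A.state_succ_regs _ net held t
    -- Each received copy is traced to its sender and to the register it was read from; the sender
    -- recomputes this register from its recorded state.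
    have hmem : ∀ u j k z, ((j, k), z) ∈ LT u → ∃ v, u ∈ net.nbrs v ∧ net.id v = j ∧
        ∃ i, (A.send (A.state (key ∘ f) net held t v).1 (comparisons (key ∘ f) (R v))
          (net.id u)).2 k = some i ∧ (R v)[i]? = some z := by
      intro u j k z h
      obtain ⟨m, hm, h1, h2⟩ := mem_labelledTokens.1 h
      obtain ⟨v, hv, rfl⟩ := List.mem_map.1 hm
      simp only [message_slot, Option.bind_eq_some_iff] at h2
      obtain ⟨i, hi, hz⟩ := h2
      exact ⟨v, by rw [net.mem_nbrs] at hv ⊢; exact hv.symm, h1, i, hi, hz⟩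
    set msg : Fin n → ℕ → Fin c → Option Y := fun u j k =>
      pick fun y => ∃ i : ℕ, ((LT u).map Prod.fst)[i]? = some (j, k) ∧
        g₁ u ((R u).length + i) = some y with hmsg
    have hmsg_spec : ∀ u j k y, msg u j k = some y → ∃ i z, (LT u)[i]? = some ((j, k), z) ∧
        g₁ u ((R u).length + i) = some y := by
      intro u j k y h
      obtain ⟨i, hi, hy⟩ := pick_spec h
      rw [List.getElem?_map, Option.map_eq_some_iff] at hi
      obtain ⟨⟨jk, z⟩, h1, rfl⟩ := hi
      exact ⟨i, z, h1, hy⟩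
    set g' : Fin n → ℕ → Option Y := fun v i =>
      pick fun y => g₁ v i = some y ∨
        ∃ m ∈ (net.nbrs v).map (fun u => (net.id u, msg u (net.id v))), ∃ k, m.2 k = some y ∧
          (A.send (A.state (key ∘ f) net held t v).1 (comparisons (key ∘ f) (R v)) m.1).2 k =
            some i with hg'
    have hnew : ∀ u i z, ((R u) ++ (LT u).map Prod.snd)[(R u).length + i]? = some z ↔
        ∃ jk, (LT u)[i]? = some (jk, z) := by
      intro u i z
      rw [List.getElem?_append_right (by omega), Nat.add_sub_cancel_left, List.getElem?_map,
        Option.map_eq_some_iff]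
      simp
    refine ⟨g', ?_, ?_, ?_⟩
    · funext v
      rw [NodeProgram.run, hrun]
      simp [-List.getElem?_map, reverse, records, state_map, received_map, labelledTokens_map_fst, comparisons_map,
        hg', hmsg, hLT, hR]
    · intro v i y z hy hz
      -- Registers are only ever appended, so a reply that stays in place keeps its token; a reply
      -- that comes back belongs to a copy of the token in register `i`.
      rcases pick_spec hy with hy | ⟨m, hm, k, hk, hi⟩
      · refine hs₁ v i y z hy ?_
        rw [hregs]
        rw [List.getElem?_append_left (List.getElem?_eq_some_iff.1 hz).1]
        exact hz
      · obtain ⟨u, hu, rfl⟩ := List.mem_map.1 hm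
        obtain ⟨l, z', hl, hyl⟩ := hmsg_spec _ _ _ _ hk
        obtain ⟨v', hv', hid, i', hi', hz'⟩ := hmem _ _ _ _ (List.mem_of_getElem? hl)
        obtain rfl := net.id_injective hid
        rw [hi] at hi'
        cases hi'
        rw [hz] at hz'
        cases hz'
        refine hs₁ u _ y z hyl ?_
        rw [hregs]
        exact (hnew u l z).2 ⟨_, hl⟩
    · intro z
      -- Either the answered copy was there before the round, or it arrived in it and its reply
      -- returns to the source register. `pick` may select another reply, which is harmless by
      -- soundness.
      obtain ⟨u, i, y, hz, hy⟩ := hc₁ z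
      rw [hregs] at hz
      by_cases hi : i < (R u).length
      · rw [List.getElem?_append_left hi] at hz
        obtain ⟨y', hy'⟩ := exists_pick (p := fun y => g₁ u i = some y ∨
          ∃ m ∈ (net.nbrs u).map (fun u' => (net.id u', msg u' (net.id u))), ∃ k, m.2 k = some y ∧
          (A.send (A.state (key ∘ f) net held t u).1 (comparisons (key ∘ f) (R u)) m.1).2 k =
            some i) (Or.inl hy)
        exact ⟨u, i, y', hz, hy'⟩
      · obtain ⟨l, rfl⟩ := Nat.exists_eq_add_of_le (not_lt.1 hi)
        obtain ⟨⟨j, k⟩, hl⟩ := (hnew u l z).1 hz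
        obtain ⟨v, hv, rfl, i', hi', hz'⟩ := hmem _ _ _ _ (List.mem_of_getElem? hl)
        obtain ⟨y₁, hy₁⟩ := exists_pick (p := fun y => ∃ i : ℕ,
          ((LT u).map Prod.fst)[i]? = some (net.id v, k) ∧ g₁ u ((R u).length + i) = some y)
          ⟨l, by rw [List.getElem?_map, hl]; rfl, hy⟩
        obtain ⟨y', hy'⟩ := exists_pick (p := fun y => g₁ v i' = some y ∨
          ∃ m ∈ (net.nbrs v).map (fun u' => (net.id u', msg u' (net.id v))), ∃ k, m.2 k = some y ∧
          (A.send (A.state (key ∘ f) net held t v).1 (comparisons (key ∘ f) (R v)) m.1).2 k =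
            some i') (Or.inr ⟨_, List.mem_map.2 ⟨u, hv, rfl⟩, k, hy₁, hi'⟩)
        exact ⟨v, i', y', hz', hy'⟩

end ComparisonAlg

/-! ### Sorting, and replying to the sorted tokens -/

theorem List.getElem?_filterMap_of_isSome {α β : Type} (f : α → Option β) (l : List α)
    (h : ∀ a ∈ l, (f a).isSome) (j : ℕ) : (l.filterMap f)[j]? = l[j]?.bind f := by
  induction l generalizing j with
  | nil => simp
  | cons a l ih =>
    obtain ⟨b, hb⟩ := Option.isSome_iff_exists.1 (h a (by simp))
    rw [List.filterMap_cons_some hb]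
    cases j with
    | zero => simp [hb]
    | succ j => simpa using ih (fun a ha => h a (by simp [ha])) j

namespace ComparisonAlg

variable {n c : ℕ}

/-- The output registers, in the order of the keys of their tokens. -/
noncomputable def outRegs (A : ComparisonAlg n c) {Z : Type} (key : Z → ℕ)
    (s : A.Ctrl × List Z) : List ℕ :=
  ((A.output s.1 (comparisons key s.2)).filter fun i => decide (i < s.2.length)).mergeSort
    fun i j => decide ((s.2.map key).getD i 0 ≤ (s.2.map key).getD j 0)

theorem outRegs_map (A : ComparisonAlg n c) {Z Z' : Type} (f : Z → Z') (key : Z' → ℕ)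
    (s : A.Ctrl × List Z) :
    A.outRegs key (s.1, s.2.map f) = A.outRegs (key ∘ f) s := by
  simp [outRegs, comparisons_map]

theorem lt_of_mem_outRegs (A : ComparisonAlg n c) {Z : Type} (key : Z → ℕ)
    (s : A.Ctrl × List Z) {i : ℕ} (hi : i ∈ A.outRegs key s) : i < s.2.length := by
  simp only [outRegs, List.mem_mergeSort, List.mem_filter, decide_eq_true_eq] at hi
  exact hi.2

/-- The output tokens, in the order of their keys. -/
noncomputable def outTokens (A : ComparisonAlg n c) {Z : Type} (key : Z → ℕ)
    (s : A.Ctrl × List Z) : List Z :=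
  (A.outRegs key s).filterMap fun i => s.2[i]?

theorem outTokens_map (A : ComparisonAlg n c) {Z Z' : Type} (f : Z → Z') (key : Z' → ℕ)
    (s : A.Ctrl × List Z) :
    A.outTokens key (s.1, s.2.map f) = (A.outTokens (key ∘ f) s).map f := by
  simp only [outTokens, outRegs_map, List.getElem?_map, List.map_filterMap]

/-- Indices out of range were filtered out of `outRegs`, so `filterMap` drops nothing and positions
of registers and tokens correspond. -/
theorem getElem?_outTokens (A : ComparisonAlg n c) {Z : Type} (key : Z → ℕ)
    (s : A.Ctrl × List Z) (j : ℕ) :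
    (A.outTokens key s)[j]? = (A.outRegs key s)[j]?.bind fun i => s.2[i]? :=
  List.getElem?_filterMap_of_isSome _ _
    (fun i hi => by simpa using A.lt_of_mem_outRegs key s hi) j

theorem outTokens_perm (A : ComparisonAlg n c) {Z : Type} (key : Z → ℕ) (s : A.Ctrl × List Z) :
    (A.outTokens key s).Perm ((A.toProgram key).output s) := by
  refine ((List.mergeSort_perm _ _).filterMap _).trans ?_
  rw [List.filterMap_filter]
  refine List.Perm.of_eq (List.filterMap_congr fun i _ => ?_)
  by_cases h : i < s.2.length
  · simp [h]
  · simp [h]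

theorem outTokens_pairwise (A : ComparisonAlg n c) {Z : Type} (key : Z → ℕ)
    (s : A.Ctrl × List Z) : (A.outTokens key s).Pairwise fun a b => key a ≤ key b := by
  have h : (A.outRegs key s).Pairwise
      fun i j => (s.2.map key).getD i 0 ≤ (s.2.map key).getD j 0 := by
    have := List.pairwise_mergeSort (le := fun i j =>
      decide ((s.2.map key).getD i 0 ≤ (s.2.map key).getD j 0))
      (fun a b c h1 h2 => by simp only [decide_eq_true_eq] at *; omega)
      (fun a b => by simp only [Bool.or_eq_true, decide_eq_true_eq]; omega)
      ((A.output s.1 (comparisons key s.2)).filter fun i => decide (i < s.2.length))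
    exact this.imp fun h => by simpa only [decide_eq_true_eq] using h
  refine List.Pairwise.filterMap _ (fun i j hij a ha b hb => ?_) h
  simpa [List.getD, List.getElem?_map, ha, hb] using hij

/-- Sort the tokens and record the execution and the output registers. -/
noncomputable def sortProgram (A : ComparisonAlg n c) {Z : Type} [Top Z] (key : Z → ℕ) (m : ℕ) :
    NodeProgram (List Z) (Word n c × (Fin c → Option Z))
      ((List (A.Record Z) × List ℕ) × (Fin m → Z)) :=
  (A.toProgram key).logged.mapOut fun s =>
    ((s.1, A.outRegs key s.2), fun j => ((A.outTokens key s.2)[j.1]?).getD ⊤)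

/-- Attach the replies to the sorted tokens to their registers. -/
noncomputable def replies {Y : Type} (regs : List ℕ) (ρ : ℕ → Y) (i : ℕ) : Option Y :=
  pick fun y => ∃ j : ℕ, regs[j]? = some i ∧ ρ j = y

/-- The sorting algorithm permutes tokens that fill all vertices, it sorts them, and the reversed
execution brings a reply to every token back to its origin. -/
theorem SolvesSorting.exists_perm {A : ComparisonAlg n c} {φ : ℝ} {Δ N m T : ℕ}
    (hA : A.SolvesSorting φ Δ N m T) {net : Network n} (hnet : net.Admissible φ Δ N)
    {Z : Type} [LinearOrder Z] [Top Z] (key : Z → ℕ) (hkey : ∀ a b, key a ≤ key b ↔ a ≤ b)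
    (x : Fin n → Fin m → Z) :
    ∃ (e : (Fin n × Fin m) ≃ (Fin n × Fin m)) (out : Fin n → Fin m → Z)
      (rec : Fin n → List (A.Record Z) × List ℕ),
      ((A.sortProgram key m).result net (fun v => List.ofFn (x v)) T = fun v => (rec v, out v)) ∧
      (∀ z, out (e z).1 (e z).2 = x z.1 z.2) ∧
      (∀ v, Monotone (out v)) ∧
      (∀ v v', net.id v < net.id v' → ∀ j j', out v j ≤ out v' j') ∧
      ∀ (Y : Type) (ρ : Fin n → ℕ → Y) (v : Fin n) (i : Fin m),
        (A.reverse key Y).result net (fun v => ((rec v).1, replies (rec v).2 (ρ v))) T v i =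
          some (ρ (e (v, i)).1 (e (v, i)).2) := by
  set f : Fin n × Fin m → Z := fun z => x z.1 z.2 with hf
  set held : Fin n → List (Fin n × Fin m) := fun v => List.ofFn fun j => (v, j) with hheld
  have hx : (fun v => List.ofFn (x v)) = fun v => (held v).map f := by
    funext v
    simp [hheld, hf, List.map_ofFn, Function.comp_def]
  have hheld_get : ∀ v i (z : Fin n × Fin m), (held v)[i]? = some z ↔ v = z.1 ∧ i = z.2.1 := by
    rintro v i ⟨u, j⟩
    simp only [hheld, List.getElem?_ofFn]
    split_ifs with h
    · simp only [Option.some.injEq, Prod.mk.injEq, Fin.ext_iff]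
    · simp only [false_iff]
      rintro ⟨-, rfl⟩
      exact h j.2
  have hplace : IsPlacement held := by
    refine ⟨fun z => ⟨z.1, ?_, ?_⟩, fun v => ?_⟩
    · exact List.mem_of_getElem? ((hheld_get _ _ _).2 ⟨rfl, rfl⟩)
    · intro v hv
      obtain ⟨i, hi⟩ := List.mem_iff_getElem?.1 hv
      exact ((hheld_get _ _ _).1 hi).1
    · exact List.nodup_ofFn.2 fun i j h => (Prod.mk.inj h).2
  -- The guarantee is applied to the labels, which are distinct even where their values agree.
  obtain ⟨⟨huniq, hnodup⟩, hlen, hsorted⟩ := hA net hnet _ (key ∘ f) held hplace (by simp [hheld])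
  set st := A.state (key ∘ f) net held T with hst
  have hperm : ∀ v, (A.outTokens (key ∘ f) (st v)).Perm
      ((A.toProgram (key ∘ f)).result net held T v) := fun v => A.outTokens_perm _ _
  set outZ := fun v => A.outTokens (key ∘ f) (st v) with houtZ
  have hex : ∀ z, ∃ p : Fin n × Fin m, (outZ p.1)[p.2.1]? = some z := by
    intro z
    obtain ⟨v, hv, -⟩ := huniq z
    obtain ⟨j, hj⟩ := List.mem_iff_getElem?.1 ((hperm v).mem_iff.2 hv)
    have hj' := (List.getElem?_eq_some_iff.1 hj).1
    exact ⟨(v, ⟨j, hj'.trans_le ((hperm v).length_eq.trans_le (hlen v))⟩), hj⟩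
  choose e he using hex
  have hinj : Function.Injective e := fun z z' h => by
    have := he z
    rw [h, he z'] at this
    exact (Option.some.inj this).symm
  -- `n * m` tokens with load at most `m` fill every place; hence the default `⊤` in `sortProgram`
  -- never occurs.
  have hbij : Function.Bijective e := Finite.injective_iff_bijective.1 hinj
  have hpos : ∀ v j z, (outZ v)[j]? = some z → v = (e z).1 ∧ j = (e z).2.1 := by
    intro v j z h
    have h1 : v = (e z).1 := (huniq z).unique
      ((hperm v).mem_iff.1 (List.mem_of_getElem? h))
      ((hperm _).mem_iff.1 (List.mem_of_getElem? (he z)))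
    refine ⟨h1, ?_⟩
    have hn : (outZ v).Nodup := (hperm v).nodup_iff.2 (hnodup v)
    have h2 := he z
    rw [← h1] at h2
    exact (List.getElem?_inj (List.getElem?_eq_some_iff.1 h).1 hn).1 (h.trans h2.symm)
  set E := Equiv.ofBijective e hbij with hE
  have hout : ∀ v (j : Fin m), (outZ v)[j.1]? = some (E.symm (v, j)) := by
    intro v j
    have := he (E.symm (v, j))
    have h2 : e (E.symm (v, j)) = (v, j) := E.apply_symm_apply (v, j)
    rwa [h2] at this
  set out : Fin n → Fin m → Z := fun v j => f (E.symm (v, j)) with hout_def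
  refine ⟨E, out, fun v => (A.records key net (fun v => (held v).map f) T v,
    A.outRegs (key ∘ f) (st v)), ?_, ?_, ?_, ?_, ?_⟩
  · rw [hx]
    unfold sortProgram
    rw [NodeProgram.mapOut_result, NodeProgram.logged_result]
    funext v
    have hs : (A.toProgram key).run net (fun v => (held v).map f) T v =
      ((st v).1, (st v).2.map f) := A.state_map f key net held T v
    simp only [hs]
    refine Prod.ext (Prod.ext (A.log_eq_records _ _ _ _ _) (A.outRegs_map f key (st v))) ?_
    funext j
    dsimp only
    rw [outTokens_map, List.getElem?_map]
    show ((outZ v)[j.1]?.map f).getD ⊤ = _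
    rw [hout]
    rfl
  · intro z
    show f (E.symm (E z)) = f z
    rw [Equiv.symm_apply_apply]
  · intro v j j' hjj
    rcases hjj.eq_or_lt with rfl | hlt
    · exact le_rfl
    · rw [← hkey]
      obtain ⟨h1, h1'⟩ := List.getElem?_eq_some_iff.1 (hout v j)
      obtain ⟨h2, h2'⟩ := List.getElem?_eq_some_iff.1 (hout v j')
      have := List.pairwise_iff_getElem.1 (A.outTokens_pairwise (key ∘ f) (st v)) _ _ h1 h2 hlt
      rw [h1', h2'] at this
      exact this
  · intro v v' hid j j'
    rw [← hkey]
    exact hsorted v v' hid _ ((hperm v).mem_iff.1 (List.mem_of_getElem? (hout v j)))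
      _ ((hperm v').mem_iff.1 (List.mem_of_getElem? (hout v' j')))
  · intro Y ρ v i
    set g : Fin n → ℕ → Option Y := fun v => replies (A.outRegs (key ∘ f) (st v)) (ρ v) with hg
    have hget : ∀ v j, (outZ v)[j]? = (A.outRegs (key ∘ f) (st v))[j]?.bind fun i => (st v).2[i]? :=
      fun v j => A.getElem?_outTokens _ _ _
    obtain ⟨g', hrun, hs, hc⟩ := A.reverse_run f key net held
      (fun z => ρ (E z).1 (E z).2.1) g T T 0 (Nat.zero_add T)
      (by
        intro v i y z hy hz
        obtain ⟨j, hj, rfl⟩ := pick_spec hy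
        have h := hget v j
        rw [hj] at h
        obtain ⟨rfl, rfl⟩ := hpos v j z (h.trans hz)
        rfl)
      (by
        intro z
        have h := hget (e z).1 (e z).2.1
        rw [he z] at h
        obtain ⟨i, hi, hz⟩ := Option.bind_eq_some_iff.1 h.symm
        obtain ⟨y, hy⟩ := exists_pick (p := fun y => ∃ j : ℕ,
          (A.outRegs (key ∘ f) (st (e z).1))[j]? = some i ∧ ρ (e z).1 j = y) ⟨_, hi, rfl⟩
        exact ⟨(e z).1, i, y, hz, hy⟩)
    have hres : (A.reverse key Y).result net (fun v =>
        (A.records key net (fun v => (held v).map f) T v, g v)) T v = g' v := by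
      rw [NodeProgram.result, hrun]
      rfl
    show (A.reverse key Y).result net (fun v =>
        (A.records key net (fun v => (held v).map f) T v, g v)) T v i = _
    rw [hres]
    -- At time `0` the label `(v, i)` lies only in register `i` of `v`, so that register must hold
    -- the reply.
    obtain ⟨v', i', y, hz, hy⟩ := hc (v, i)
    have hz' : (held v')[i']? = some (v, i) := hz
    obtain ⟨rfl, rfl⟩ := (hheld_get _ _ _).1 hz'
    rw [hy, hs _ _ _ _ hy hz]

end ComparisonAlg

/-! ### Sorted sequences cut into blocks -/

theorem Network.exists_rank {n : ℕ} (net : Network n) :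
    ∃ σ : Fin n ≃ Fin n, StrictMono (net.id ∘ σ) :=
  ⟨Tuple.sort net.id, (Tuple.monotone_sort net.id).strictMono_of_injective
    (net.id_injective.comp (Tuple.sort net.id).injective)⟩

/-- Concatenate the blocks `out (σ 0)`, `out (σ 1)`, …, and continue with `⊤`. -/
noncomputable def blockSeq {n m : ℕ} {Z : Type} [Top Z] (σ : Fin n ≃ Fin n)
    (out : Fin n → Fin m → Z) (p : ℕ) : Z :=
  if h : p < n * m then
    out (σ (finProdFinEquiv.symm ⟨p, h⟩).1) (finProdFinEquiv.symm ⟨p, h⟩).2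
  else ⊤

theorem blockSeq_of_le {n m : ℕ} {Z : Type} [Top Z] (σ : Fin n ≃ Fin n)
    (out : Fin n → Fin m → Z) {p : ℕ} (h : n * m ≤ p) : blockSeq σ out p = ⊤ :=
  dif_neg (not_lt.2 h)

theorem blockSeq_apply {n m : ℕ} {Z : Type} [Top Z] (σ : Fin n ≃ Fin n)
    (out : Fin n → Fin m → Z) (r : Fin n) (j : Fin m) :
    blockSeq σ out (j + m * r) = out (σ r) j := by
  have h : (j : ℕ) + m * r < n * m := (finProdFinEquiv (r, j)).2
  have h2 : finProdFinEquiv.symm ⟨(j : ℕ) + m * r, h⟩ = (r, j) :=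
    (Equiv.symm_apply_eq _).2 rfl
  rw [blockSeq, dif_pos h, h2]

theorem sum_range_mul_eq {n m : ℕ} {B : Type} [AddCommMonoid B] (W : ℕ → B) :
    ∑ p ∈ Finset.range (n * m), W p = ∑ r : Fin n, ∑ j : Fin m, W (j + m * r) := by
  rw [Finset.sum_range, ← finProdFinEquiv.sum_comp, Fintype.sum_prod_type]
  rfl

theorem sum_blockSeq {n m : ℕ} {Z B : Type} [Top Z] [AddCommMonoid B] (σ : Fin n ≃ Fin n)
    (out : Fin n → Fin m → Z) (F : Z → B) :
    ∑ p ∈ Finset.range (n * m), F (blockSeq σ out p) = ∑ z : Fin n × Fin m, F (out z.1 z.2) := by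
  rw [sum_range_mul_eq, Fintype.sum_prod_type, ← σ.sum_comp fun v => ∑ j, F (out v j)]
  simp only [blockSeq_apply]

theorem blockSeq_mono {n m : ℕ} {Z : Type} [PartialOrder Z] [OrderTop Z] (net : Network n)
    (σ : Fin n ≃ Fin n) (hσ : StrictMono (net.id ∘ σ)) (out : Fin n → Fin m → Z)
    (hout : ∀ v, Monotone (out v))
    (hcross : ∀ v v', net.id v < net.id v' → ∀ j j', out v j ≤ out v' j') :
    Monotone (blockSeq σ out) := by
  intro p q hpq
  by_cases hq : q < n * m
  · have hp := hpq.trans_lt hq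
    obtain ⟨⟨r, j⟩, hrj⟩ := finProdFinEquiv.surjective ⟨p, hp⟩
    obtain ⟨⟨r', j'⟩, hrj'⟩ := finProdFinEquiv.surjective ⟨q, hq⟩
    have h1 : (j : ℕ) + m * r = p := congrArg Fin.val hrj
    have h2 : (j' : ℕ) + m * r' = q := congrArg Fin.val hrj'
    rw [← h1, ← h2, blockSeq_apply, blockSeq_apply]
    rcases lt_trichotomy r r' with h | rfl | h
    · exact hcross _ _ (hσ h) _ _
    · exact hout _ (by rw [Fin.le_def]; omega)
    · exfalso
      have : m * (r' + 1) ≤ m * (r : ℕ) := Nat.mul_le_mul_left m h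
      have := j'.2
      rw [mul_add] at *
      omega
  · rw [blockSeq_of_le σ out (not_lt.1 hq)]
    exact le_top

/-- A multiset has at most one sorted listing. Writing it as a sum of singletons lets permutations
of places act by reindexing. -/
theorem eq_of_monotone_of_sum_eq {Z : Type} [PartialOrder Z] {f g : ℕ → Z} (hf : Monotone f)
    (hg : Monotone g) {K : ℕ}
    (h : ∑ p ∈ Finset.range K, ({f p} : Multiset Z) = ∑ p ∈ Finset.range K, {g p}) {p : ℕ}
    (hp : p < K) : f p = g p := by
  have key : ∀ f : ℕ → Z, ∑ p ∈ Finset.range K, ({f p} : Multiset Z) =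
      (((List.range K).map f : List Z) : Multiset Z) := by
    intro f
    clear h hp
    induction K with
    | zero => rfl
    | succ K ih =>
      rw [Finset.sum_range_succ, ih, List.range_succ, List.map_append, ← Multiset.coe_add]
      rfl
  have hs : ∀ f : ℕ → Z, Monotone f → ((List.range K).map f).Pairwise (· ≤ ·) := fun f hf =>
    List.pairwise_map.2 (List.pairwise_lt_range.imp fun h => hf h.le)
  rw [key, key, Multiset.coe_eq_coe] at h
  have := h.eq_of_pairwise (fun a b _ _ => le_antisymm) (hs f hf) (hs g hg)
  exact List.map_inj_left.1 this p (List.mem_range.2 hp)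

/-- If the first `L` tokens of the first block are replaced by `⊤`, sorting shifts the sequence. -/
theorem blockSeq_shift {n m L : ℕ} {Z : Type} [PartialOrder Z] [OrderTop Z] (hL : L ≤ m)
    (σ : Fin n ≃ Fin n) (out x out' : Fin n → Fin m → Z)
    (hx : ∀ r j, x (σ r) j = if (r : ℕ) = 0 ∧ (j : ℕ) < L then ⊤ else out (σ r) j)
    (e : (Fin n × Fin m) ≃ (Fin n × Fin m)) (he : ∀ z, out' (e z).1 (e z).2 = x z.1 z.2)
    (hout : Monotone (blockSeq σ out)) (hout' : Monotone (blockSeq σ out')) {p : ℕ}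
    (hp : p < n * m) : blockSeq σ out' p = blockSeq σ out (p + L) := by
  refine eq_of_monotone_of_sum_eq hout' (fun a b h => hout (Nat.add_le_add_right h L)) ?_ hp
  set c : ℕ → Z := fun p => if p < L then ⊤ else blockSeq σ out p with hc
  have h1 : ∑ p ∈ Finset.range (n * m), ({blockSeq σ out' p} : Multiset Z) =
      ∑ p ∈ Finset.range (n * m), {c p} := by
    rw [sum_blockSeq σ out' (fun t => ({t} : Multiset Z)), ← e.sum_comp]
    simp only [he]
    rw [Fintype.sum_prod_type, ← σ.sum_comp, sum_range_mul_eq]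
    refine Finset.sum_congr rfl fun r _ => Finset.sum_congr rfl fun j _ => ?_
    rw [hx, hc]
    simp only [blockSeq_apply]
    congr 1
    have hiff : ((r : ℕ) = 0 ∧ (j : ℕ) < L) ↔ (j : ℕ) + m * r < L := by
      constructor
      · rintro ⟨h, h'⟩
        simpa [h] using h'
      · intro h
        rcases Nat.eq_zero_or_pos (r : ℕ) with h0 | h0
        · exact ⟨h0, by omega⟩
        · have := Nat.le_mul_of_pos_right m h0
          omega
    simp only [hiff]
  -- The range `n * m + L` is split in two ways: the first `L` values of `c` and the `L` values past
  -- the end are all `⊤` and cancel.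
  have h2 := Finset.sum_range_add (fun p => ({c p} : Multiset Z)) (n * m) L
  have h3 := Finset.sum_range_add (fun p => ({c p} : Multiset Z)) L (n * m)
  rw [add_comm L, h2, add_comm] at h3
  have h4 : ∑ p ∈ Finset.range L, ({c (n * m + p)} : Multiset Z) =
      ∑ p ∈ Finset.range L, {c p} := by
    refine Finset.sum_congr rfl fun p hp => ?_
    have hp := Finset.mem_range.1 hp
    simp only [hc, hp, if_true, blockSeq_of_le σ out (Nat.le_add_right (n * m) p), ite_self]
  rw [h4] at h3
  rw [h1, add_left_cancel h3]
  refine Finset.sum_congr rfl fun p _ => ?_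
  simp [hc, add_comm]

/-! ### Tokens of the reduction -/

/-- The tokens that are sorted: blank tokens `⊤`, and for each destination a dummy token, followed
by the routed tokens for that destination, by their data. -/
abbrev Tok (N M : ℕ) : Type := WithTop (Fin (N + 1) ×ₗ WithBot (Fin M))

namespace Tok

variable {N M : ℕ}

/-- The dummy token that belongs to the vertex with identifier `d`. -/
def dummy (d : Fin (N + 1)) : Tok N M := ((toLex (d, ⊥) : Fin (N + 1) ×ₗ WithBot (Fin M)) : Tok N M)

/-- The token with destination `d` and data `y`. -/
def real (d : Fin (N + 1)) (y : Fin M) : Tok N M :=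
  ((toLex (d, (y : WithBot (Fin M))) : Fin (N + 1) ×ₗ WithBot (Fin M)) : Tok N M)

theorem dummy_le_dummy {d d' : Fin (N + 1)} : (dummy d : Tok N M) ≤ dummy d' ↔ d ≤ d' := by
  rw [dummy, dummy, WithTop.coe_le_coe, Prod.Lex.toLex_le_toLex]
  simp [le_iff_lt_or_eq]

theorem dummy_injective : Function.Injective (dummy : Fin (N + 1) → Tok N M) := fun _ _ h =>
  le_antisymm (dummy_le_dummy.1 h.le) (dummy_le_dummy.1 h.ge)

theorem dummy_ne_top (d : Fin (N + 1)) : (dummy d : Tok N M) ≠ ⊤ := WithTop.coe_ne_top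

theorem real_ne_top (d : Fin (N + 1)) (y : Fin M) : real d y ≠ ⊤ := WithTop.coe_ne_top

theorem dummy_lt_real (d : Fin (N + 1)) (y : Fin M) : dummy d < real d y := by
  simp [dummy, real, Prod.Lex.toLex_lt_toLex]

theorem real_inj {d d' : Fin (N + 1)} {y y' : Fin M} : real d y = real d' y' ↔ d = d' ∧ y = y' := by
  simp [real]

theorem dummy_ne_real (d d' : Fin (N + 1)) (y : Fin M) : dummy d ≠ real d' y := by
  simp [dummy, real]

/-- In the lexicographic order the tokens of one destination form an interval with the dummy at its
bottom. -/
theorem eq_dummy_or_eq_real {d : Fin (N + 1)} {y : Fin M} {t : Tok N M} (h1 : dummy d ≤ t)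
    (h2 : t ≤ real d y) : t = dummy d ∨ ∃ y', t = real d y' := by
  induction t using WithTop.recTopCoe with
  | top => exact absurd (top_le_iff.1 h2) (real_ne_top d y)
  | coe t =>
    obtain ⟨⟨d', o⟩, rfl⟩ := toLex.surjective t
    simp only [dummy, real, WithTop.coe_le_coe, Prod.Lex.toLex_le_toLex] at h1 h2
    have hd : d' = d := by
      refine le_antisymm ?_ ?_
      · rcases h2 with h | h
        exacts [h.le, h.1.le]
      · rcases h1 with h | h
        exacts [h.le, h.1.le]
    subst hd
    induction o using WithBot.recBotCoe with
    | bot => exact Or.inl rfl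
    | coe y' => exact Or.inr ⟨y', rfl⟩

theorem card_tok : Fintype.card (Tok N M) = (N + 1) * (M + 1) + 1 := by
  have h : Fintype.card (WithBot (Fin M)) = M + 1 := by
    rw [show Fintype.card (WithBot (Fin M)) = Fintype.card (Option (Fin M)) from
      Fintype.card_congr (Equiv.refl _)]
    simp
  rw [show Fintype.card (Tok N M) = Fintype.card (Option (Fin (N + 1) × WithBot (Fin M))) from
      Fintype.card_congr (Equiv.refl _)]
  simp [h]

/-- The key of a token: its position in the order of all tokens. -/
noncomputable def key (t : Tok N M) : ℕ := (Finset.univ.filter fun s : Tok N M => s < t).card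

theorem key_le_key {s t : Tok N M} : key s ≤ key t ↔ s ≤ t := by
  have h : StrictMono (key : Tok N M → ℕ) := fun s t hst =>
    Finset.card_lt_card (Finset.ssubset_iff_of_subset
      (fun u hu => by simp at hu ⊢; exact hu.trans hst) |>.2 ⟨s, by simpa using hst, by simp⟩)
  exact h.le_iff_le

end Tok

theorem pick_eq_some {Y : Type} {p : Y → Prop} {y : Y} (h : p y) (hu : ∀ y', p y' → y' = y) :
    pick p = some y := by
  obtain ⟨y', hy'⟩ := exists_pick h
  rw [hy', hu y' (pick_spec hy')]

theorem pick_eq_none {Y : Type} {p : Y → Prop} (h : ∀ y, ¬ p y) : pick p = none :=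
  dif_neg fun ⟨y, hy⟩ => h y hy

/-! ### Matching dummies with the routed tokens `L` positions behind them -/

section Matching

variable {N M L n : ℕ}

/-- The token with destination `d` and the given data, if there are any. -/
def payload (d : ℕ) (o : Option (Fin M)) : Multiset RouteToken := o.elim 0 fun y => {⟨d, y⟩}

/-- The routed token with destination `d` that `t` stands for, if there is one. -/
noncomputable def routed (d : Fin (N + 1)) (t : Tok N M) : Multiset RouteToken :=
  payload d (pick fun y => t = Tok.real d y)

theorem routed_real (d : Fin (N + 1)) (y : Fin M) : routed d (Tok.real d y) = {⟨d, y⟩} := by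
  rw [routed, pick_eq_some (p := fun y' => Tok.real d y = Tok.real d y') rfl
    fun y' h => (Tok.real_inj.1 h).2.symm]
  rfl

theorem routed_eq_zero {d : Fin (N + 1)} {t : Tok N M} (h : ∀ y, t ≠ Tok.real d y) :
    routed d t = 0 := by
  rw [routed, pick_eq_none h]
  rfl

open Classical in
/-- In a sorted sequence with `L` dummy tokens and at most `L` routed tokens for the destination
`d`, every routed token stands `L` positions behind a dummy token. -/
theorem sum_routed_shift {S : ℕ → Tok N M} (hS : Monotone S) {K : ℕ} (htop : ∀ p, K ≤ p → S p = ⊤)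
    (d : Fin (N + 1))
    (hD : ∑ p ∈ Finset.range K, (if S p = Tok.dummy d then 1 else 0) = L)
    (hR : (∑ p ∈ Finset.range K, routed d (S p)).card ≤ L) :
    ∑ p ∈ Finset.range K, (if S p = Tok.dummy d then routed d (S (p + L)) else 0) =
      ∑ p ∈ Finset.range K, routed d (S p) := by
  rw [Finset.sum_boole, Nat.cast_id] at hD
  have hR' : ((Finset.range K).filter fun p => ∃ y, S p = Tok.real d y).card ≤ L := by
    refine le_trans (le_of_eq ?_) hR
    rw [Multiset.card_sum, Finset.card_filter]
    refine Finset.sum_congr rfl fun p _ => ?_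
    split_ifs with h
    · obtain ⟨y, hy⟩ := h
      rw [hy, routed_real]
      rfl
    · rw [routed_eq_zero fun y hy => h ⟨y, hy⟩]
      rfl
  have hlt : ∀ {p}, S p ≠ ⊤ → p < K := fun {p} h => by
    by_contra hp
    exact h (htop p (not_lt.1 hp))
  -- All `L` dummies lie before `p`, so the first of them is at or before `p - L`, and `p - L` holds
  -- a token for `d`. Were it a routed one, the `L + 1` positions from `p - L` to `p` would all be
  -- routed tokens for `d`.
  have key : ∀ p y, S p = Tok.real d y → ∃ q, q + L = p ∧ S q = Tok.dummy d := by
    intro p y hp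
    have hpK : p < K := hlt (hp ▸ Tok.real_ne_top d y)
    set D := (Finset.range K).filter fun p => S p = Tok.dummy d with hDdef
    have hDlt : ∀ q ∈ D, q < p := by
      intro q hq
      by_contra h
      have h1 := hS (not_lt.1 h)
      rw [(Finset.mem_filter.1 hq).2, hp] at h1
      exact absurd h1 (not_le.2 (Tok.dummy_lt_real d y))
    have hL0 : 0 < L := lt_of_lt_of_le (Finset.card_pos.2
      ⟨p, Finset.mem_filter.2 ⟨Finset.mem_range.2 hpK, y, hp⟩⟩) hR'
    have hne : D.Nonempty := Finset.card_pos.1 (hD ▸ hL0)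
    set a := D.min' hne with ha
    have haD : S a = Tok.dummy d := (Finset.mem_filter.1 (D.min'_mem hne)).2
    have hsub : D ⊆ Finset.Ico a p := fun q hq =>
      Finset.mem_Ico.2 ⟨D.min'_le q hq, hDlt q hq⟩
    have hcard := Finset.card_le_card hsub
    rw [hD, Nat.card_Ico] at hcard
    refine ⟨p - L, by omega, ?_⟩
    have h1 : Tok.dummy d ≤ S (p - L) := haD ▸ hS (by omega)
    have h2 : S (p - L) ≤ Tok.real d y := hp ▸ hS (by omega)
    rcases Tok.eq_dummy_or_eq_real h1 h2 with h | ⟨y', h⟩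
    · exact h
    · exfalso
      have hsub' : Finset.Icc (p - L) p ⊆
          (Finset.range K).filter fun p => ∃ y, S p = Tok.real d y := by
        intro q hq
        rw [Finset.mem_Icc] at hq
        refine Finset.mem_filter.2 ⟨Finset.mem_range.2 (by omega), ?_⟩
        have h3 : Tok.real d y' ≤ S q := h ▸ hS hq.1
        have h4 : S q ≤ Tok.real d y := hp ▸ hS hq.2
        rcases Tok.eq_dummy_or_eq_real ((Tok.dummy_lt_real d y').le.trans h3) h4 with h5 | h5
        · rw [h5] at h3
          exact absurd h3 (not_le.2 (Tok.dummy_lt_real d y'))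
        · exact h5
      have := Finset.card_le_card hsub'
      rw [Nat.card_Icc] at this
      omega
  -- No routed token for `d` stands in the first `L` positions or from `K` on, so shifting the
  -- summation range by `L` changes nothing.
  have hsplit := Finset.sum_range_add (fun p => routed d (S p)) K L
  have hsplit' := Finset.sum_range_add (fun p => routed d (S p)) L K
  rw [Nat.add_comm L K, hsplit] at hsplit'
  have h1 : ∑ p ∈ Finset.range L, routed d (S (K + p)) = 0 :=
    Finset.sum_eq_zero fun p _ => routed_eq_zero fun y hy =>
      Tok.real_ne_top d y (hy.symm.trans (htop _ (Nat.le_add_right K p)))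
  have h2 : ∑ p ∈ Finset.range L, routed d (S p) = 0 :=
    Finset.sum_eq_zero fun p hp => routed_eq_zero fun y hy => by
      obtain ⟨q, hq, -⟩ := key p y hy
      have := Finset.mem_range.1 hp
      omega
  rw [h1, h2, add_zero, zero_add] at hsplit'
  rw [hsplit']
  refine Finset.sum_congr rfl fun p _ => ?_
  rw [Nat.add_comm L p]
  split_ifs with h
  · rfl
  · refine (routed_eq_zero fun y hy => h ?_).symm
    obtain ⟨q, hq, hq'⟩ := key _ y hy
    rwa [← Nat.add_right_cancel hq]

/-- The data of the routed token that stands `L` positions behind the dummy token at position `k`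
of a sorted block. -/
noncomputable def matched (out : Fin (2 * L) → Tok N M) (k : ℕ) : Option (Fin M) :=
  pick fun y => ∃ (d : Fin (N + 1)) (h : k < L), out ⟨k, by omega⟩ = Tok.dummy d ∧
    out ⟨k + L, by omega⟩ = Tok.real d y

theorem matched_eq_none {out : Fin (2 * L) → Tok N M} {k : Fin (2 * L)}
    (h : ∀ d, out k ≠ Tok.dummy d) : matched out k = none :=
  pick_eq_none fun _ ⟨d, _, hd, _⟩ => h d hd

theorem matched_eq (out : Fin (2 * L) → Tok N M) {k : ℕ} (h : k < L) {d : Fin (N + 1)}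
    (hd : out ⟨k, by omega⟩ = Tok.dummy d) :
    matched out k = pick fun y => out ⟨k + L, by omega⟩ = Tok.real d y := by
  rw [matched]
  congr 1
  funext y
  refine propext ⟨?_, fun hy => ⟨d, h, hd, hy⟩⟩
  rintro ⟨d', _, hd', hy⟩
  rw [hd] at hd'
  rwa [Tok.dummy_injective hd']

-- Block length `2 * L` keeps the partner of a first-half position in the same block; second halves
-- yield nothing locally.
open Classical in
theorem payload_matched_blockSeq (σ : Fin n ≃ Fin n) (out : Fin n → Fin (2 * L) → Tok N M)
    (d : Fin (N + 1)) (r : Fin n) (k : Fin (2 * L)) :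
    (if out (σ r) k = Tok.dummy d then payload d (matched (out (σ r)) k) else 0) =
      if (k : ℕ) < L then
        if blockSeq σ out (k + 2 * L * r) = Tok.dummy d then
          routed d (blockSeq σ out (k + 2 * L * r + L)) else 0
      else 0 := by
  rw [blockSeq_apply]
  by_cases hk : (k : ℕ) < L
  · have h1 : (k : ℕ) + 2 * L * r + L = ((⟨k + L, by omega⟩ : Fin (2 * L)) : ℕ) + 2 * L * r := by
      simp only; ring
    rw [if_pos hk, h1, blockSeq_apply]
    split_ifs with hd
    · rw [matched_eq _ hk hd]
      rfl
    · rfl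
  · rw [if_neg hk, matched, pick_eq_none fun y ⟨_, h, _⟩ => hk h]
    exact ite_self _

theorem sum_halves {B : Type} [AddCommMonoid B] (G : ℕ → B) :
    ∑ k : Fin (2 * L), (if (k : ℕ) < L then G k else 0) +
      ∑ k : Fin (2 * L), (if (k : ℕ) < L then G (k + L) else 0) = ∑ k : Fin (2 * L), G k := by
  have h : ∀ F : ℕ → B, ∑ k : Fin (2 * L), F k =
      ∑ k ∈ Finset.range L, F k + ∑ k ∈ Finset.range L, F (L + k) := by
    intro F
    rw [← Finset.sum_range_add, ← two_mul, Finset.sum_range]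
  rw [h (fun k => if k < L then G k else 0), h (fun k => if k < L then G (k + L) else 0), h G]
  have h0 : ∀ G : ℕ → B, ∑ k ∈ Finset.range L, (if L + k < L then G k else 0) = 0 := fun G =>
    Finset.sum_eq_zero fun k _ => if_neg (by omega)
  have h1 : ∀ G : ℕ → B, ∑ k ∈ Finset.range L, (if k < L then G k else 0) =
      ∑ k ∈ Finset.range L, G k := fun G =>
    Finset.sum_congr rfl fun k hk => if_pos (Finset.mem_range.1 hk)
  rw [h1, h1 fun k => G (k + L), h0 fun k => G (L + k), h0 fun k => G (L + k + L), add_zero,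
    add_zero]
  simp only [Nat.add_comm]

open Classical in
/-- The replies to the dummy tokens for `d`, from the first sorting and from the second, in which
the blocks are shifted by half their length, are the routed tokens for `d`. -/
theorem sum_replies (net : Network n) (σ : Fin n ≃ Fin n) (hσ : StrictMono (net.id ∘ σ))
    {x₁ out₁ x₂ out₂ : Fin n → Fin (2 * L) → Tok N M}
    {e₁ e₂ : (Fin n × Fin (2 * L)) ≃ (Fin n × Fin (2 * L))}
    (he₁ : ∀ z, out₁ (e₁ z).1 (e₁ z).2 = x₁ z.1 z.2) (hm₁ : ∀ v, Monotone (out₁ v))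
    (hc₁ : ∀ v v', net.id v < net.id v' → ∀ j j', out₁ v j ≤ out₁ v' j')
    (he₂ : ∀ z, out₂ (e₂ z).1 (e₂ z).2 = x₂ z.1 z.2) (hm₂ : ∀ v, Monotone (out₂ v))
    (hc₂ : ∀ v v', net.id v < net.id v' → ∀ j j', out₂ v j ≤ out₂ v' j')
    (hx₂ : ∀ r j, x₂ (σ r) j = if (r : ℕ) = 0 ∧ (j : ℕ) < L then ⊤ else out₁ (σ r) j)
    (d : Fin (N + 1))
    (hD : ∑ z : Fin n × Fin (2 * L), (if x₁ z.1 z.2 = Tok.dummy d then 1 else 0) = L)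
    (hR : (∑ z : Fin n × Fin (2 * L), routed d (x₁ z.1 z.2)).card ≤ L) :
    ∑ z : Fin n × Fin (2 * L), (if x₁ z.1 z.2 = Tok.dummy d then
        payload d (matched (out₁ (e₁ z).1) (e₁ z).2) +
          payload d (matched (out₂ (e₂ (e₁ z)).1) (e₂ (e₁ z)).2) else 0) =
      ∑ z : Fin n × Fin (2 * L), routed d (x₁ z.1 z.2) := by
  have hS₁ := blockSeq_mono net σ hσ out₁ hm₁ hc₁
  have hS₂ := blockSeq_mono net σ hσ out₂ hm₂ hc₂
  have hshift := fun p (hp : p < n * (2 * L)) =>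
    blockSeq_shift (p := p) (by omega) σ out₁ x₂ out₂ hx₂ e₂ he₂ hS₁ hS₂ hp
  have hseq : ∀ {B : Type} [AddCommMonoid B] (F : Tok N M → B),
      ∑ z : Fin n × Fin (2 * L), F (x₁ z.1 z.2) =
        ∑ p ∈ Finset.range (n * (2 * L)), F (blockSeq σ out₁ p) := by
    intro B _ F
    rw [sum_blockSeq, ← e₁.sum_comp fun z => F (out₁ z.1 z.2)]
    simp only [he₁]
  rw [hseq fun t => if t = Tok.dummy d then 1 else 0] at hD
  rw [hseq] at hR ⊢
  rw [← sum_routed_shift hS₁ (fun p hp => blockSeq_of_le σ out₁ hp) d hD hR, sum_range_mul_eq]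
  set W : ℕ → Multiset RouteToken := fun p => if blockSeq σ out₁ p = Tok.dummy d then
    routed d (blockSeq σ out₁ (p + L)) else 0 with hW
  have hfirst : ∑ q : Fin n × Fin (2 * L), (if out₁ q.1 q.2 = Tok.dummy d then
      payload d (matched (out₁ q.1) q.2) else 0) =
      ∑ r : Fin n, ∑ k : Fin (2 * L), if (k : ℕ) < L then W (k + 2 * L * r) else 0 := by
    rw [Fintype.sum_prod_type, ← σ.sum_comp]
    simp only [payload_matched_blockSeq, hW]
  -- By the shift, position `k` of a block after the second sorting is position `k + L` of the same
  -- block after the first.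
  have hsecond : ∑ q : Fin n × Fin (2 * L), (if out₂ q.1 q.2 = Tok.dummy d then
      payload d (matched (out₂ q.1) q.2) else 0) =
      ∑ r : Fin n, ∑ k : Fin (2 * L), if (k : ℕ) < L then W (k + L + 2 * L * r) else 0 := by
    rw [Fintype.sum_prod_type, ← σ.sum_comp]
    simp only [payload_matched_blockSeq, hW]
    refine Finset.sum_congr rfl fun r _ => Finset.sum_congr rfl fun k _ => ?_
    by_cases hk : (k : ℕ) < L
    · have hlt : ((⟨k + L, by omega⟩ : Fin (2 * L)) : ℕ) + 2 * L * r < n * (2 * L) :=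
        (finProdFinEquiv (r, (⟨k + L, by omega⟩ : Fin (2 * L)))).2
      simp only at hlt
      rw [if_pos hk, if_pos hk, hshift _ (by omega), hshift _ (by omega),
        show (k : ℕ) + 2 * L * r + L = k + L + 2 * L * r by ring]
    · rw [if_neg hk, if_neg hk]
  have hsum : ∑ z : Fin n × Fin (2 * L), (if x₁ z.1 z.2 = Tok.dummy d then
        payload d (matched (out₁ (e₁ z).1) (e₁ z).2) +
          payload d (matched (out₂ (e₂ (e₁ z)).1) (e₂ (e₁ z)).2) else 0) =
      ∑ q : Fin n × Fin (2 * L), (if out₁ q.1 q.2 = Tok.dummy d then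
        payload d (matched (out₁ q.1) q.2) else 0) +
      ∑ q : Fin n × Fin (2 * L), (if out₂ q.1 q.2 = Tok.dummy d then
        payload d (matched (out₂ q.1) q.2) else 0) := by
    rw [← e₂.sum_comp fun q => if out₂ q.1 q.2 = Tok.dummy d then
        payload d (matched (out₂ q.1) q.2) else 0, ← Finset.sum_add_distrib,
      ← e₁.sum_comp fun q => (if out₁ q.1 q.2 = Tok.dummy d then
        payload (d : ℕ) (matched (out₁ q.1) q.2) else 0) + _]
    refine Finset.sum_congr rfl fun z _ => ?_
    rw [← he₁]
    generalize e₁ z = q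
    obtain ⟨r, hr⟩ := σ.surjective q.1
    have h := he₂ q
    rw [← hr, hx₂, hr] at h
    split_ifs at h with h0
    -- A dummy blanked before the second sorting still collects a second reply at its origin; that
    -- reply is empty because it answers a blank.
    · have hz : matched (out₂ (e₂ q).1) (e₂ q).2 = none :=
        matched_eq_none fun d hd => Tok.dummy_ne_top d (hd.symm.trans h)
      rw [hz, show payload (M := M) d none = 0 from rfl, add_zero, ite_self, add_zero]
    · rw [h]
      split_ifs <;> simp
  rw [hsum, hfirst, hsecond, ← Finset.sum_add_distrib]
  refine Finset.sum_congr rfl fun r _ => ?_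
  exact sum_halves fun k => W (k + 2 * L * r)

/-- When every vertex holds one dummy token with its own identifier and otherwise blank tokens,
sorting brings its own token back to the vertex with the smallest identifier only. -/
theorem dummy_mem_iff {m : ℕ} (hm : 2 ≤ m) (net : Network n) (σ : Fin n ≃ Fin n)
    (hσ : StrictMono (net.id ∘ σ)) (δ : Fin n → Fin (N + 1)) (hδ : StrictMono (δ ∘ σ))
    {x out : Fin n → Fin m → Tok N M} {e : (Fin n × Fin m) ≃ (Fin n × Fin m)}
    (hx : ∀ v j, x v j = if (j : ℕ) = 0 then Tok.dummy (δ v) else ⊤)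
    (he : ∀ z, out (e z).1 (e z).2 = x z.1 z.2) (hmono : ∀ v, Monotone (out v))
    (hcross : ∀ v v', net.id v < net.id v' → ∀ j j', out v j ≤ out v' j') (r : Fin n) :
    (∃ j, out (σ r) j = Tok.dummy (δ (σ r))) ↔ (r : ℕ) = 0 := by
  set c : ℕ → Tok N M := fun p => if h : p < n then Tok.dummy (δ (σ ⟨p, h⟩)) else ⊤ with hc
  have hcmono : Monotone c := by
    intro p q hpq
    by_cases hq : q < n
    · simp only [hc, hq, hpq.trans_lt hq, dif_pos, Tok.dummy_le_dummy]
      exact hδ.monotone hpq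
    · simp only [hc, hq, dif_neg, not_false_eq_true]
      exact le_top
  have hm1 : m = 1 + (m - 1) := by omega
  have hseq : ∀ p, p < n * m → blockSeq σ out p = c p := by
    intro p hp
    refine eq_of_monotone_of_sum_eq (blockSeq_mono net σ hσ out hmono hcross) hcmono ?_ hp
    rw [sum_blockSeq σ out (fun t => ({t} : Multiset (Tok N M))), ← e.sum_comp]
    simp only [he]
    have hnm : n * m = n + n * (m - 1) := by
      conv_lhs => rw [hm1]
      ring
    rw [hnm, Finset.sum_range_add, Fintype.sum_prod_type, ← σ.sum_comp]
    have h1 : ∀ v, ∑ j, ({x v j} : Multiset (Tok N M)) =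
        {Tok.dummy (δ v)} + (m - 1) • ({⊤} : Multiset (Tok N M)) := by
      intro v
      have h := Finset.sum_range (n := m)
        (fun j => ({if j = 0 then Tok.dummy (δ v) else ⊤} : Multiset (Tok N M)))
      simp only [hx]
      rw [← h]
      conv_lhs => rw [hm1, Finset.sum_range_add]
      simp
    simp only [h1, Finset.sum_add_distrib]
    congr 1
    · rw [Finset.sum_range]
      simp [hc]
    · simp [hc, mul_smul]
  constructor
  · rintro ⟨j, hj⟩
    have hlt : (j : ℕ) + m * r < n * m := (finProdFinEquiv (r, j)).2
    rw [← blockSeq_apply σ out, hseq _ hlt] at hj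
    simp only [hc] at hj
    split_ifs at hj with h
    · have h2 := hδ.injective (Tok.dummy_injective hj)
      have h3 : (j : ℕ) + m * r = r := congrArg Fin.val h2
      by_contra h0
      have := Nat.mul_le_mul_right (r : ℕ) hm
      omega
    · exact absurd hj.symm (Tok.dummy_ne_top _)
  · intro hr
    refine ⟨⟨0, by omega⟩, ?_⟩
    have hn := r.2
    rw [← blockSeq_apply σ out, hr, hseq _ (by simpa using ⟨by omega, by omega⟩)]
    have h : (0 : ℕ) + m * 0 = r := by omega
    simp only [hc, h, hn, dif_pos, Fin.eta]

end Matching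

/-! ### The reduction -/

/-- A program whose messages fit into words is a `CONGEST` algorithm. -/
theorem NodeProgram.exists_congestAlg {I M O : Type} [Fintype M] [Nonempty M] {n c : ℕ}
    (P : NodeProgram I M O) (h : Fintype.card M ≤ 2 ^ (c * bits n)) :
    ∃ Q : CongestAlg n c I O, ∀ (net : Network n) (inp : Fin n → I) (t : ℕ),
      Q.result net inp t = P.result net inp t := by
  obtain ⟨enc⟩ : Nonempty (M ↪ Word n c) := Function.Embedding.nonempty_of_card_le (by simpa using h)
  exact ⟨P.mapMsg enc (Function.invFun enc), fun net inp t =>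
    P.mapMsg_result enc _ (Function.leftInverse_invFun enc.injective) net inp t⟩

/-! ### Message sizes -/

theorem pow_le_two_pow_bits (n a : ℕ) : n ^ a ≤ 2 ^ (a * bits n) := by
  rw [mul_comm, pow_mul]
  exact Nat.pow_le_pow_left (Nat.lt_pow_succ_log_self one_lt_two n).le a

/-- The additive constants (dummy, blank, empty slot) cost at most 3 bits per slot, absorbed by `3 *
bits n`. The last summand is room for replies, so that sorting and reversal share one word size. -/
theorem card_sortMessage_le (n a b c : ℕ) :
    Fintype.card (Word n c × (Fin c → Option (Tok (n ^ a) (2 ^ (b * bits n))))) ≤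
      2 ^ ((c + c * (a + b + 3) + c * (2 * b + 3)) * bits n) := by
  have hB : 1 ≤ bits n := Nat.le_add_left 1 _
  have h1 : n ^ a + 1 ≤ 2 ^ (a * bits n + 1) := by
    rw [pow_succ]
    have := pow_le_two_pow_bits n a
    have := Nat.one_le_two_pow (n := a * bits n)
    omega
  have h2 : 2 ^ (b * bits n) + 1 ≤ 2 ^ (b * bits n + 1) := by
    rw [pow_succ]
    have := Nat.one_le_two_pow (n := b * bits n)
    omega
  have h3 : (n ^ a + 1) * (2 ^ (b * bits n) + 1) + 1 + 1 ≤ 2 ^ ((a + b + 3) * bits n) := by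
    calc (n ^ a + 1) * (2 ^ (b * bits n) + 1) + 1 + 1
        ≤ 2 ^ (a * bits n + 1) * 2 ^ (b * bits n + 1) + 1 + 1 := by gcongr
      _ = 2 ^ ((a + b) * bits n + 2) + 1 + 1 := by rw [← pow_add]; ring_nf
      _ ≤ 2 ^ ((a + b) * bits n + 3) := by
          rw [pow_succ 2 ((a + b) * bits n + 2)]
          have : 2 ^ 2 ≤ 2 ^ ((a + b) * bits n + 2) :=
            Nat.pow_le_pow_right two_pos (Nat.le_add_left _ _)
          omega
      _ ≤ 2 ^ ((a + b + 3) * bits n) := by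
          refine Nat.pow_le_pow_right two_pos ?_
          rw [add_mul (a + b) 3]
          omega
  rw [Fintype.card_prod, Fintype.card_fun, Fintype.card_option, Tok.card_tok, Fintype.card_fin,
    Fintype.card_fin]
  calc 2 ^ (c * bits n) * ((n ^ a + 1) * (2 ^ (b * bits n) + 1) + 1 + 1) ^ c
      ≤ 2 ^ (c * bits n) * (2 ^ ((a + b + 3) * bits n)) ^ c := by gcongr
    _ = 2 ^ ((c + c * (a + b + 3)) * bits n) := by rw [← pow_mul, ← pow_add]; ring_nf
    _ ≤ _ := Nat.pow_le_pow_right two_pos (Nat.mul_le_mul_right _ (Nat.le_add_right _ _))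

theorem card_replyMessage_le (n a b c : ℕ) :
    Fintype.card (Fin c → Option (Option (Fin (2 ^ (b * bits n))) ×
      Option (Fin (2 ^ (b * bits n))))) ≤
      2 ^ ((c + c * (a + b + 3) + c * (2 * b + 3)) * bits n) := by
  have hB : 1 ≤ bits n := Nat.le_add_left 1 _
  have h2 : 2 ^ (b * bits n) + 1 ≤ 2 ^ (b * bits n + 1) := by
    rw [pow_succ]
    have := Nat.one_le_two_pow (n := b * bits n)
    omega
  have h3 : (2 ^ (b * bits n) + 1) * (2 ^ (b * bits n) + 1) + 1 ≤ 2 ^ ((2 * b + 3) * bits n) := by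
    calc (2 ^ (b * bits n) + 1) * (2 ^ (b * bits n) + 1) + 1
        ≤ 2 ^ (b * bits n + 1) * 2 ^ (b * bits n + 1) + 1 := by gcongr
      _ = 2 ^ (2 * b * bits n + 2) + 1 := by rw [← pow_add]; ring_nf
      _ ≤ 2 ^ (2 * b * bits n + 3) := by
          rw [pow_succ 2 (2 * b * bits n + 2)]
          have := Nat.one_le_two_pow (n := 2 * b * bits n + 2)
          omega
      _ ≤ 2 ^ ((2 * b + 3) * bits n) := by
          refine Nat.pow_le_pow_right two_pos ?_
          rw [add_mul (2 * b) 3]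
          omega
  rw [Fintype.card_fun, Fintype.card_option, Fintype.card_prod, Fintype.card_option,
    Fintype.card_fin, Fintype.card_fin]
  calc ((2 ^ (b * bits n) + 1) * (2 ^ (b * bits n) + 1) + 1) ^ c
      ≤ (2 ^ ((2 * b + 3) * bits n)) ^ c := by gcongr
    _ = 2 ^ (c * (2 * b + 3) * bits n) := by rw [← pow_mul]; ring_nf
    _ ≤ _ := Nat.pow_le_pow_right two_pos (Nat.mul_le_mul_right _ (Nat.le_add_left _ _))

/-! ### Tokens entering the first sorting, and tokens delivered at the end -/

section Routing

variable {N M L : ℕ}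

/-- The tokens that a vertex contributes to the first sorting: `L` dummy tokens with its own
identifier, and the tokens to be routed, filled up with blank tokens. -/
noncomputable def routingTokens (N M L : ℕ) [NeZero M] (i : ℕ) (held : List RouteToken)
    (j : ℕ) : Tok N M :=
  if j < L then Tok.dummy (Fin.ofNat (N + 1) i) else
    (held[j - L]?).elim ⊤ fun t => Tok.real (Fin.ofNat (N + 1) t.dst) (Fin.ofNat M t.data)

theorem sum_getElem?_elim {A B : Type} [AddCommMonoid B] (F : A → B) (l : List A)
    (h : l.length ≤ L) :
    ∑ k ∈ Finset.range L, (l[k]?).elim 0 F = (l.map F).sum := by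
  induction l generalizing L with
  | nil => simp
  | cons a l ih =>
    obtain ⟨L, rfl⟩ : ∃ L', L = L' + 1 := ⟨L - 1, by simp at h; omega⟩
    rw [Finset.sum_range_succ']
    simp only [List.getElem?_cons_succ, List.getElem?_cons_zero]
    rw [ih (by simpa using h)]
    simp [add_comm]

open Classical in
theorem sum_routed_routingTokens [NeZero M] (i : ℕ) (held : List RouteToken) (hlen : held.length ≤ L)
    (hheld : ∀ z ∈ held, z.dst ≤ N ∧ z.data < M) (d : Fin (N + 1)) :
    ∑ j : Fin (2 * L), routed d (routingTokens N M L i held j) =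
      (held : Multiset RouteToken).filter fun z => z.dst = (d : ℕ) := by
  have h1 := Finset.sum_range (n := 2 * L) (fun j => routed d (routingTokens N M L i held j))
  rw [← h1, two_mul, Finset.sum_range_add,
    Finset.sum_eq_zero (s := Finset.range L) fun j hj => ?_, zero_add]
  · have h2 : ∀ j ∈ Finset.range L, routed d (routingTokens N M L i held (L + j)) =
        (held[j]?).elim 0 fun z => if z.dst = (d : ℕ) then {z} else 0 := by
      intro j _
      rw [routingTokens, if_neg (by omega), Nat.add_sub_cancel_left]
      cases hz : held[j]? with
      | none => exact routed_eq_zero fun y hy => Tok.real_ne_top d y hy.symm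
      | some z =>
        obtain ⟨hz1, hz2⟩ := hheld z (List.mem_of_getElem? hz)
        have e1 : ((Fin.ofNat (N + 1) z.dst : Fin (N + 1)) : ℕ) = z.dst :=
          Nat.mod_eq_of_lt (Nat.lt_succ_of_le hz1)
        have e2 : ((Fin.ofNat M z.data : Fin M) : ℕ) = z.data := Nat.mod_eq_of_lt hz2
        simp only [Option.elim_some]
        split_ifs with h
        · have h' : Fin.ofNat (N + 1) z.dst = d := Fin.ext (e1.trans h)
          rw [h', routed_real, e2, ← h]
        · exact routed_eq_zero fun y hy => h (by rw [← e1, (Tok.real_inj.1 hy).1])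
    rw [Finset.sum_congr rfl h2, sum_getElem?_elim _ _ hlen]
    clear hlen hheld h1 h2
    induction held with
    | nil => rfl
    | cons z l ih =>
      rw [List.map_cons, List.sum_cons, ih, ← Multiset.cons_coe, Multiset.filter_cons]
  · rw [routingTokens, if_pos (Finset.mem_range.1 hj)]
    exact routed_eq_zero fun y => Tok.dummy_ne_real _ _ y

open Classical in
theorem tokensTo_eq_sum {n : ℕ} (held : Fin n → List RouteToken) (d : ℕ) :
    tokensTo held d = ∑ v, (held v : Multiset RouteToken).filter fun z => z.dst = d := by
  unfold tokensTo
  induction (Finset.univ : Finset (Fin n)) using Finset.induction_on with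
  | empty => rfl
  | insert v s hv ih => rw [Finset.sum_insert hv, Finset.sum_insert hv, Multiset.filter_add, ih]

/-- The routed token with destination `d` and the given data, if there are any, as a list. -/
def payloadList (d : ℕ) (o : Option (Fin M)) : List RouteToken := o.elim [] fun y => [⟨d, y⟩]

/-- The tokens that are delivered to the vertex with identifier `d` when the replies to its `L`
dummy tokens are `g`. -/
def collect (L d : ℕ) (g : ℕ → Option (Option (Fin M) × Option (Fin M))) : List RouteToken :=
  (List.range L).flatMap fun j => (g j).elim [] fun y => payloadList d y.1 ++ payloadList d y.2

theorem coe_collect (d : ℕ) (g : ℕ → Option (Option (Fin M) × Option (Fin M))) :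
    (collect L d g : Multiset RouteToken) =
      ∑ j ∈ Finset.range L, (g j).elim 0 fun y => payload d y.1 + payload d y.2 := by
  have hp : ∀ o : Option (Fin M), (payloadList d o : Multiset RouteToken) = payload d o := by
    intro o
    cases o <;> rfl
  unfold collect
  induction L with
  | zero => rfl
  | succ L ih =>
    rw [List.range_succ, List.flatMap_append, ← Multiset.coe_add, ih, Finset.sum_range_succ]
    congr 1
    rw [List.flatMap_singleton]
    cases g L with
    | none => rfl
    | some y => simp [← hp]

end Routing

open Classical in
theorem ComparisonAlg.SolvesSorting.exists_routing {n c a b Δ L T : ℕ} {φ : ℝ}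
    {A : ComparisonAlg n c} (hA : A.SolvesSorting φ Δ (n ^ a) (2 * L) T) :
    ∃ R : CongestAlg n (c + c * (a + b + 3) + c * (2 * b + 3)) (List RouteToken) (List RouteToken),
      R.SolvesRouting φ Δ (n ^ a) b L (T + (T + (T + (T + T)))) := by
  set N := n ^ a with hN
  set M := 2 ^ (b * bits n) with hM
  have : NeZero M := ⟨(Nat.two_pow_pos _).ne'⟩
  obtain ⟨QS, hQS⟩ := (A.sortProgram (Tok.key : Tok N M → ℕ) (2 * L)).exists_congestAlg
    (card_sortMessage_le n a b c)
  obtain ⟨QR, hQR⟩ := (A.reverse (Tok.key : Tok N M → ℕ)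
    (Option (Fin M) × Option (Fin M))).exists_congestAlg (card_replyMessage_le n a b c)
  let SortOut : Type := (List (A.Record (Tok N M)) × List ℕ) × (Fin (2 * L) → Tok N M)
  let Replies : Type := ℕ → Option (Option (Fin M) × Option (Fin M))
  let pre₀ : ℕ → List RouteToken → List RouteToken × List (Tok N M) := fun i held =>
    (held, List.ofFn fun j : Fin (2 * L) =>
      if (j : ℕ) = 0 then Tok.dummy (Fin.ofNat (N + 1) i) else ⊤)
  let pre₁ : ℕ → List RouteToken × SortOut → Prop × List (Tok N M) := fun i s =>
    (∃ j, s.2.2 j = Tok.dummy (Fin.ofNat (N + 1) i),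
      List.ofFn fun j : Fin (2 * L) => routingTokens N M L i s.1 j)
  let pre₂ : ℕ → Prop × SortOut → SortOut × List (Tok N M) := fun _ s =>
    (s.2, List.ofFn fun j : Fin (2 * L) => if s.1 ∧ (j : ℕ) < L then ⊤ else s.2.2 j)
  -- Input slots of the second sorting are output slots of the first, so undoing the second brings
  -- its answers to the sorted blocks of the first; `pre₄` adds the answers found there before the
  -- last reversal.
  let pre₃ : ℕ → SortOut × SortOut → SortOut × (List (A.Record (Tok N M)) × Replies) := fun _ s =>
    (s.1, s.2.1.1, ComparisonAlg.replies s.2.1.2 fun k => (matched s.2.2 k, none))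
  let pre₄ : ℕ → SortOut × Replies → ℕ × (List (A.Record (Tok N M)) × Replies) := fun i s =>
    (i, s.1.1.1, ComparisonAlg.replies s.1.1.2 fun k =>
      (matched s.1.2 k, (s.2 k).elim none Prod.fst))
  refine ⟨(NodeProgram.withContext pre₀ QS).seq T ((NodeProgram.withContext pre₁ QS).seq T
    ((NodeProgram.withContext pre₂ QS).seq T ((NodeProgram.withContext pre₃ QR).seq T
      ((NodeProgram.withContext pre₄ QR).mapOut fun s => collect L s.1 s.2)))), ?_⟩
  intro net hnet held hheld hlen hdst v
  simp only [NodeProgram.seq_result, NodeProgram.withContext_result, NodeProgram.mapOut_result,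
    hQS, hQR]
  obtain ⟨σ, hσ⟩ := net.exists_rank
  set δ : Fin n → Fin (N + 1) := fun v => Fin.ofNat (N + 1) (net.id v) with hδ
  have hδval : ∀ v, (δ v : ℕ) = net.id v := fun v =>
    Nat.mod_eq_of_lt (Nat.lt_succ_of_le (hnet.2.2 v).2)
  have hδmono : StrictMono (δ ∘ σ) := fun r r' h => by
    rw [Fin.lt_def]
    simpa only [Function.comp, hδval] using hσ h
  obtain ⟨e₀, out₀, rec₀, hrun₀, he₀, hm₀, hc₀, -⟩ := hA.exists_perm hnet Tok.key
    (fun _ _ => Tok.key_le_key)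
    (fun v (j : Fin (2 * L)) => if (j : ℕ) = 0 then (Tok.dummy (Fin.ofNat (N + 1) (net.id v)) : Tok N M) else ⊤)
  obtain ⟨e₁, out₁, rec₁, hrun₁, he₁, hm₁, hc₁, hrep₁⟩ := hA.exists_perm hnet Tok.key
    (fun _ _ => Tok.key_le_key)
    (fun v (j : Fin (2 * L)) => routingTokens N M L (net.id v) (held v) j)
  obtain ⟨e₂, out₂, rec₂, hrun₂, he₂, hm₂, hc₂, hrep₂⟩ := hA.exists_perm hnet Tok.key
    (fun _ _ => Tok.key_le_key)
    (fun v (j : Fin (2 * L)) => if (∃ j, out₀ v j = Tok.dummy (Fin.ofNat (N + 1) (net.id v))) ∧ (j : ℕ) < L then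
      (⊤ : Tok N M) else out₁ v j)
  simp only [pre₀, pre₁, pre₂, pre₃, pre₄]
  simp only [hrun₀, hrun₁, hrun₂]
  set g : Fin n → Replies := (A.reverse Tok.key (Option (Fin M) × Option (Fin M))).result net
    (fun v => ((rec₂ v).1, ComparisonAlg.replies (rec₂ v).2 fun k => (matched (out₂ v) k, none))) T
    with hg
  have hgval : ∀ q : Fin n × Fin (2 * L), g q.1 q.2 =
      some (matched (out₂ (e₂ q).1) (e₂ q).2, none) := fun q => hrep₂ _ _ q.1 q.2
  have hheld' : ∀ u, ∀ z ∈ held u, z.dst ≤ N ∧ z.data < M := fun u z hz =>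
    ⟨(hheld u z hz).1.2, (hheld u z hz).2⟩
  have hx₁ : ∀ u (j : ℕ), routingTokens N M L (net.id u) (held u) j = Tok.dummy (δ v) ↔
      u = v ∧ j < L := by
    intro u j
    unfold routingTokens
    split_ifs with hj
    · constructor
      · intro h
        have h2 := congrArg Fin.val (Tok.dummy_injective h)
        exact ⟨net.id_injective (by rw [← hδval u, ← hδval v]; exact h2), hj⟩
      · rintro ⟨rfl, -⟩
        rfl
    · refine iff_of_false ?_ fun h => hj h.2
      cases (held u)[j - L]? with
      | none => exact (Tok.dummy_ne_top _).symm
      | some z => exact (Tok.dummy_ne_real _ _ _).symm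
  have hpick : ∀ {B : Type} [AddCommMonoid B] (F : Fin n × Fin (2 * L) → B),
      ∑ z : Fin n × Fin (2 * L), (if routingTokens N M L (net.id z.1) (held z.1) z.2 =
        Tok.dummy (δ v) then F z else 0) =
      ∑ j : Fin (2 * L), if (j : ℕ) < L then F (v, j) else 0 := by
    intro B _ F
    rw [Fintype.sum_prod_type, Finset.sum_eq_single v]
    · simp only [hx₁, true_and]
    · intro u _ hu
      simp only [hx₁, hu, false_and, if_false, Finset.sum_const_zero]
    · simp
  have hhalf : ∀ {B : Type} [AddCommMonoid B] (G : ℕ → B),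
      ∑ j : Fin (2 * L), (if (j : ℕ) < L then G j else 0) = ∑ j ∈ Finset.range L, G j := by
    intro B _ G
    have h := Finset.sum_range (n := 2 * L) (fun j => if j < L then G j else 0)
    rw [← h, two_mul, Finset.sum_range_add, Finset.sum_congr rfl fun j hj =>
      if_pos (Finset.mem_range.1 hj), Finset.sum_eq_zero fun j _ => if_neg (by omega), add_zero]
  have hD : ∑ z : Fin n × Fin (2 * L), (if routingTokens N M L (net.id z.1) (held z.1) z.2 =
      Tok.dummy (δ v) then 1 else 0) = L := by
    rw [hpick fun _ => 1, hhalf fun _ => 1]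
    simp
  have hR : ∑ z : Fin n × Fin (2 * L),
      routed (δ v) (routingTokens N M L (net.id z.1) (held z.1) z.2) = tokensTo held (net.id v) := by
    rw [Fintype.sum_prod_type]
    simp only
    rw [Finset.sum_congr rfl fun u _ =>
      sum_routed_routingTokens (net.id u) (held u) (hlen u) (hheld' u) (δ v), hδval, tokensTo_eq_sum]
  -- For `L = 0` the blocks are empty and the test fails everywhere, but then there is nothing to
  -- blank.
  have hfirst : ∀ r : Fin n, 0 < L →
      ((∃ j, out₀ (σ r) j = Tok.dummy (Fin.ofNat (N + 1) (net.id (σ r)))) ↔ (r : ℕ) = 0) :=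
    fun r hL => dummy_mem_iff (by omega) net σ hσ δ hδmono (fun _ _ => rfl) he₀ hm₀ hc₀ r
  have hmain := sum_replies net σ hσ
    (x₁ := fun u j => routingTokens N M L (net.id u) (held u) j)
    (x₂ := fun v j => if (∃ j, out₀ v j = Tok.dummy (Fin.ofNat (N + 1) (net.id v))) ∧
      (j : ℕ) < L then (⊤ : Tok N M) else out₁ v j)
    he₁ hm₁ hc₁ he₂ hm₂ hc₂ (fun r j => by
      by_cases hj : (j : ℕ) < L
      · simp only [hfirst r (by omega)]
      · simp only [hj, and_false, if_false]) (δ v) hD (by rw [hR]; exact hdst _)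
  rw [hR, hpick] at hmain
  rw [coe_collect, ← hmain, ← hhalf]
  refine Finset.sum_congr rfl fun j _ => ?_
  split_ifs
  · rw [hrep₁]
    simp only [Option.elim_some, hgval, hδval]
  · rfl

end Congest

theorem mainTheorem8 :
    -- the constant in `O(1)` is universal
    ∃ C : ℕ,
      -- identifiers lie in `[1, n ^ a]`, routed tokens carry `b * bits n` bits, messages of the
      -- sorting algorithm have size `c`; those of the routing algorithm have `c' * bits n` bits
      ∀ a b c : ℕ, ∃ c' : ℕ,
        -- `Δ n` bounds the maximum degree of the networks on `n` vertices
        ∀ (Δ : ℕ → ℕ) (Tsort : ℕ → ℝ → ℕ → ℕ)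
          (Asort : (n : ℕ) → ℝ → ℕ → Congest.ComparisonAlg n c),
          (∀ (n : ℕ) (φ : ℝ) (L : ℕ), 0 < φ →
            (Asort n φ L).SolvesSorting φ (Δ n) (n ^ a) L (Tsort n φ L)) →
          ∃ (Troute : ℕ → ℝ → ℕ → ℕ)
            (Aroute : (n : ℕ) → ℝ → ℕ →
              Congest.CongestAlg n c' (List Congest.RouteToken) (List Congest.RouteToken)),
            ∀ (n : ℕ) (φ : ℝ) (L : ℕ), 0 < φ →
              Troute n φ L ≤ C * Tsort n φ (2 * L) ∧
              Congest.CongestAlg.SolvesRouting (Aroute n φ L) φ (Δ n) (n ^ a) b L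
                (Troute n φ L) := by
  refine ⟨5, fun a b c => ⟨c + c * (a + b + 3) + c * (2 * b + 3), fun Δ Tsort Asort h => ?_⟩⟩
  have hex : ∀ (n : ℕ) (φ : ℝ) (L : ℕ), ∃ R : Congest.CongestAlg n
      (c + c * (a + b + 3) + c * (2 * b + 3)) (List Congest.RouteToken) (List Congest.RouteToken),
      0 < φ → R.SolvesRouting φ (Δ n) (n ^ a) b L (5 * Tsort n φ (2 * L)) := by
    intro n φ L
    by_cases hφ : 0 < φ
    · obtain ⟨R, hR⟩ := (h n φ (2 * L) hφ).exists_routing (b := b)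
      refine ⟨R, fun _ => ?_⟩
      convert hR using 1
      ring
    -- Nothing is claimed for `φ ≤ 0`; a trivial program makes the choice total.
    · exact ⟨⟨Unit, fun _ _ _ => (), fun _ _ => ⟨0, Nat.two_pow_pos _⟩, fun _ _ => (),
        fun _ => []⟩, fun h => absurd h hφ⟩
  choose R hR using hex
  exact ⟨fun n φ L => 5 * Tsort n φ (2 * L), R, fun n φ L hφ => ⟨le_rfl, hR n φ L hφ⟩⟩
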